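/- Let $n\ge 1$. Let $H_n$ be the Hopf superalgebra over $\mathbb C$ generated by $K^{\pm1}$ (even) and $X$ (odd) with $K^n=1$, $KX=XK$, $X^2=0$, $\Delta(K)=K\otimes K$, $\Delta(X)=K\otimes X+X\otimes 1$, $\varepsilon(K)=1$, $\varepsilon(X)=0$, $S(K)=K^{-1}$, $S(X)=-K^{-1}X$. Let $B=\mathbb C[K^{\pm1}]/(K^n-1)\subset H_n$, let $G(B^*)$ be the group of algebra maps $B\to\mathbb C$ under convolution, and let $\pi_B:H_n\to B$ be given by $\pi_B(K^a)=K^a$, $\pi_B(K^aX)=0$. Take the relative integral $\mu:H_n\to B$, $\mu(K^a)=0$, $\mu(K^aX)=K^a$, and the cointegral $\iota=\frac1n\left(\sum_{a=0}^{n-1}K^a\right)X$. Let $(M,\gamma)$ be a balanced sutured $3$-manifold with $R_-(\gamma)$ connected, and let $\mathcal H=(\Sigma,\boldsymbol\alpha^e,\boldsymbol\beta^e)$ be an ordered, oriented, based extended Heegaard diagram of it. That is, $\Sigma$ is a compact oriented surface; $\boldsymbol\alpha^e$ consists of $d$ oriented, pairwise disjoint closed curves $\alpha_1,\dots,\alpha_d$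 in the interior of $\Sigma$, each with a base point, followed by an ordered family of oriented properly embedded arcs, disjoint from each other and from the closed curves; $\boldsymbol\beta^e$ consists in the same way of based closed curves $\beta_1,\dots,\beta_d$ followed by arcs $\beta_{d+1},\dots,\beta_{d+l}$; the curves and arcs of $\boldsymbol\alpha^e$ meet those of $\boldsymbol\beta^e$ transversely in finitely many interior points, called crossings, none of which is a base point; every component of $\Sigma\setminus\bigcup_i\alpha_i$ and of $\Sigma\setminus\bigcup_j\beta_j$ meets $\partial\Sigma$; $M$ is obtained from $\Sigma\times[-1,1]$ by attaching $2$-handles along the $\alpha_i\times\{-1\}$ and the $\beta_j\times\{1\}$, and $R_-$ (resp. $R_+$) is $\Sigma\times\{-1\}$ (resp. $\Sigma\times\{1\}$) surgered along the $\alpha_i$ (resp. the $\beta_j$); the $\alpha$-arcs (resp. $\beta$-arcs) cut each component of $R_-$ (resp. $R_+$) into a disk. The base point of an arc is its starting point. The sign $m_x$ of a crossing $x$ is $+1$ if (tangent of the $\alpha$-curve, tangent of the $\beta$-curve) is a positively oriented basis of $T_x\Sigma$, and $-1$ otherwise. Let $\beta_1^*,\dots,\beta_{d+l}^*\in H_1(M;\mathbb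 Z)$ be the dual classes: $\beta_j^*$ is represented by a loop in $\Sigma$ whose algebraic intersection number with $\beta_k$ is $\delta_{jk}$ for all $k=1,\dots,d+l$. Let $\rho:H_1(M)\to G(B^*)$ be a group homomorphism. The scalar $Z^\rho_{H_n}(\mathcal H)$ is obtained as follows, in the category of super vector spaces. To each closed curve $\alpha_i$ assign $\Delta^{(k)}(\iota)\in H_n^{\otimes k}$ and to each $\alpha$-arc assign $\Delta^{(k)}(1)=1^{\otimes k}$, where $k$ is the number of crossings on the curve or arc and the tensor factors correspond to these crossings in the order in which they are met from the base point along the orientation. To each crossing $x$ assign $\mathrm{id}_{H_n}$ if $m_x=1$ and the antipode $S$ if $m_x=-1$. To each closed curve $\beta_j$ assign $\rho(\beta_j^*)\circ\mu\circ m^{(k)}:H_n^{\otimes k}\to\mathbb C$ and to each arc $\beta_j$ assign $\rho(\beta_j^*)\circ\pi_B\circ m^{(k)}$, where $m^{(k)}$ is the iterated product and the factors again correspond to the crossings in the order met from the base point. Tensor the $\alpha$-tensors in the order of $\boldsymbol\alpha^e$ and the $\beta$-tensors in the order of $\boldsymbol\beta^e$, and contract them through the tensors of the crossings, permuting the tensor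 factors with the symmetry $v\otimes w\mapsto(-1)^{|v||w|}w\otimes v$ of super vector spaces; here the tensor product of linear maps is $(f\otimes g)(v\otimes w)=f(v)\otimes g(w)$. For $i=1,\dots,d$ let $\overline\alpha_i=\prod_x(\beta^*_{j(x)})^{m_x}$, as a word in the free group $F$ on symbols $\beta_1^*,\dots,\beta_{d+l}^*$, where $x$ runs over the crossings on $\alpha_i$ in the order met from the base point along the orientation and $\beta_{j(x)}$ is the curve or arc of $\boldsymbol\beta^e$ through $x$. Let $\partial/\partial\beta_j^*:\mathbb Z[F]\to\mathbb Z[F]$ be the Fox derivative, so $\partial(uv)=\partial u+u\,\partial v$ for $u,v\in F$ and $\partial\beta_k^*/\partial\beta_j^*=\delta_{jk}$. Let $\rho_K:\mathbb Z[H_1(M)]\to\mathbb C$ be the ring homomorphism with $\rho_K(h)=\rho(h)(K)$ for $h\in H_1(M)$, applied to elements of $\mathbb Z[F]$ through $F\to H_1(M)$, $\beta_j^*\mapsto\beta_j^*$. Then $$Z^{\rho}_{H_n}(\mathcal H)=\det\left(\rho_K\left(\frac{\partial\overline\alpha_i}{\partial\beta_j^*}\right)\right)_{i,j=1,\dots,d}.$$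 -/

import Mathlib

open scoped Manifold ContDiff

namespace Sutured

noncomputable section

open scoped TensorProduct
open CategoryTheory Set

/-! ## Singular homology in degree one and classes of loops -/

section Homology

open scoped Simplicial

/-- The integral singular chain complex of a space. -/
abbrev singularChains (M : Type) [TopologicalSpace M] : ChainComplex (ModuleCat.{0} ℤ) ℕ :=
  ((AlgebraicTopology.singularChainComplexFunctor (ModuleCat.{0} ℤ)).obj
    (ModuleCat.of ℤ ℤ)).obj (TopCat.of M)

/-- The first integral singular homology group `H₁(M)`. -/
abbrev H1 (M : Type) [TopologicalSpace M] : ModuleCat.{0} ℤ :=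
  ((AlgebraicTopology.singularHomologyFunctor (ModuleCat.{0} ℤ) 1).obj
    (ModuleCat.of ℤ ℤ)).obj (TopCat.of M)

/-- The singular 1-simplex given by the restriction of `c` to `[0,1]`. -/
def pathSimplex {M : Type} [TopologicalSpace M] (c : C(ℝ, M)) :
    (TopCat.toSSet.obj (TopCat.of M)) _⦋1⦌ :=
  (TopCat.toSSetObjEquiv (TopCat.of M) _).symm
    (c.comp ⟨fun p : stdSimplex ℝ (Fin 2) => p.1 1,
      (continuous_apply 1).comp continuous_subtype_val⟩)

/-- If `c 0 = c 1`, the 1-simplex of `c` is a cycle. -/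
theorem pathSimplex_cycle {M : Type} [TopologicalSpace M] (c : C(ℝ, M)) (hc : c 0 = c 1) :
    (TopCat.toSSet.obj (TopCat.of M)).ιChainComplex (pathSimplex c) ≫ (singularChains M).d 1 0 =
      (0 : ModuleCat.of ℤ ℤ ⟶ _) := by
  have h := SSet.ιChainComplex_d (TopCat.toSSet.obj (TopCat.of M)) (ModuleCat.of ℤ ℤ)
    (pathSimplex c)
  refine h.trans ?_
  have : (TopCat.toSSet.obj (TopCat.of M)).δ 0 (pathSimplex c) =
      (TopCat.toSSet.obj (TopCat.of M)).δ 1 (pathSimplex c) := by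
    apply (TopCat.toSSetObjEquiv (TopCat.of M) _).injective
    ext x
    have hx : x = default := Subsingleton.elim _ _
    subst hx
    change c _ = c _
    refine Eq.trans (b := c 1) ?_ (hc.symm.trans ?_)
    · congr 1
      change (stdSimplex.map (S := ℝ) (SimplexCategory.δ (n := 0) 0).toOrderHom default).1 1 = 1
      rw [show (default : stdSimplex ℝ (Fin 1)) = stdSimplex.vertex 0 from Subsingleton.elim _ _,
        stdSimplex.map_vertex]
      change (Pi.single (1 : Fin 2) (1 : ℝ) : Fin 2 → ℝ) 1 = 1
      simp
    · congr 1
      change 0 = (stdSimplex.map (S := ℝ) (SimplexCategory.δ (n := 0) 1).toOrderHom default).1 1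
      rw [show (default : stdSimplex ℝ (Fin 1)) = stdSimplex.vertex 0 from Subsingleton.elim _ _,
        stdSimplex.map_vertex]
      change 0 = (Pi.single (0 : Fin 2) (1 : ℝ) : Fin 2 → ℝ) 1
      simp
  simp [Fin.sum_univ_two, this]
  rfl

/-- The homology class in `H₁(M)` of the loop `c` restricted to `[0,1]`, where `c 0 = c 1`. -/
def loopClass {M : Type} [TopologicalSpace M] (c : C(ℝ, M)) (hc : c 0 = c 1) : H1 M :=
  ((singularChains M).liftCycles
      ((TopCat.toSSet.obj (TopCat.of M)).ιChainComplex (pathSimplex c))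
      0 (by simp) (pathSimplex_cycle c hc) ≫
    (singularChains M).homologyπ 1 : ModuleCat.of ℤ ℤ ⟶ _) (1 : ℤ)

end Homology

/-! ## Oriented surfaces, curves, arcs -/

section Surface

variable (S : Type) [TopologicalSpace S] [ChartedSpace (EuclideanHalfSpace 2) S]
  [IsManifold (𝓡∂ 2) ∞ S]

/-- An orientation of a smooth surface with boundary: `sgn y` says whether the preferred chart
at `y` (with respect to which Mathlib represents `T_y S` as `ℝ²`) is positive at `y`.
The condition says that the resulting orientation of the tangent spaces is locally constant. -/
structure SurfaceOrientation where
  sgn : S → ℤˣ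
  locally_constant : ∀ x : S, ∀ᶠ y in nhds x,
    0 < (((sgn x * sgn y : ℤˣ) : ℤ) : ℝ) *
      LinearMap.det (tangentCoordChange (𝓡∂ 2) y x y).toLinearMap

variable {S}

/-- The oriented area `v ∧ w` of two tangent vectors at `y`, up to a positive factor:
it is positive iff `(v, w)` is a positively oriented basis of `T_y S`. -/
def SurfaceOrientation.area (o : SurfaceOrientation S) (y : S)
    (v w : EuclideanSpace ℝ (Fin 2)) : ℝ :=
  ((o.sgn y : ℤ) : ℝ) * (v 0 * w 1 - v 1 * w 0)

/-- The velocity of a curve `c : ℝ → S` at time `t`. -/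
def velocity (c : ℝ → S) (t : ℝ) : EuclideanSpace ℝ (Fin 2) :=
  mfderiv 𝓘(ℝ, ℝ) (𝓡∂ 2) c t (1 : ℝ)

/-- The velocity at time `t ∈ [0,1]` of a curve that matters only on `[0,1]`. -/
def velocityWithin (c : ℝ → S) (t : ℝ) : EuclideanSpace ℝ (Fin 2) :=
  mfderivWithin 𝓘(ℝ, ℝ) (𝓡∂ 2) c (Icc 0 1) t (1 : ℝ)

/-- An oriented smoothly embedded circle in the interior of `S` with a base point, together with
a tubular neighbourhood. The circle is `t ↦ tube t 0` with `t ∈ ℝ/ℤ` and its base point is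
`tube 0 0`. -/
structure ClosedCurve (o : SurfaceOrientation S) where
  tube : ℝ → ℝ → S
  smooth : ContMDiffOn 𝓘(ℝ, ℝ × ℝ) (𝓡∂ 2) ∞ (fun p : ℝ × ℝ => tube p.1 p.2)
    (univ ×ˢ Ioo (-2) 2)
  periodic : ∀ t s, tube (t + 1) s = tube t s
  injective : ∀ t s t' s', s ∈ Ioo (-2 : ℝ) 2 → s' ∈ Ioo (-2 : ℝ) 2 →
    tube t s = tube t' s' → s = s' ∧ ∃ k : ℤ, t' = t + k
  interior : ∀ t, ∀ s ∈ Ioo (-2 : ℝ) 2, (𝓡∂ 2).IsInteriorPoint (tube t s)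
  positive : ∀ t, ∀ s ∈ Ioo (-2 : ℝ) 2,
    0 < o.area (tube t s) (velocity (fun t' => tube t' s) t) (velocity (fun s' => tube t s') s)

/-- An oriented properly embedded smooth arc `t ↦ tube t 0`, `t ∈ [0,1]`, in `S`, together with a
tubular neighbourhood. -/
structure ProperArc (o : SurfaceOrientation S) where
  tube : ℝ → ℝ → S
  smooth : ContMDiffOn 𝓘(ℝ, ℝ × ℝ) (𝓡∂ 2) ∞ (fun p : ℝ × ℝ => tube p.1 p.2)
    (Icc 0 1 ×ˢ Ioo (-2) 2)
  injective : ∀ t ∈ Icc (0 : ℝ) 1, ∀ s ∈ Ioo (-2 : ℝ) 2, ∀ t' ∈ Icc (0 : ℝ) 1,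
    ∀ s' ∈ Ioo (-2 : ℝ) 2, tube t s = tube t' s' → t = t' ∧ s = s'
  boundary : ∀ t ∈ Icc (0 : ℝ) 1, ∀ s ∈ Ioo (-2 : ℝ) 2,
    (𝓡∂ 2).IsBoundaryPoint (tube t s) ↔ t = 0 ∨ t = 1
  positive : ∀ t ∈ Icc (0 : ℝ) 1, ∀ s ∈ Ioo (-2 : ℝ) 2,
    0 < o.area (tube t s) (velocityWithin (fun t' => tube t' s) t)
      (velocity (fun s' => tube t s') s)

/-- The image of the tube of radius `r` around a closed curve. -/
def ClosedCurve.nbhd {o : SurfaceOrientation S} (c : ClosedCurve o) (r : ℝ) : Set S :=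
  {x | ∃ t, ∃ s ∈ Ioo (-r) r, c.tube t s = x}

/-- The image of the tube of radius `r` around a proper arc. -/
def ProperArc.nbhd {o : SurfaceOrientation S} (c : ProperArc o) (r : ℝ) : Set S :=
  {x | ∃ t ∈ Icc (0 : ℝ) 1, ∃ s ∈ Ioo (-r) r, c.tube t s = x}

/-- A family of `d` circles and `l` arcs in `S`, ordered (circles before arcs), oriented, with a
base point on each circle, and pairwise disjoint. -/
structure CurveSystem (o : SurfaceOrientation S) (d l : ℕ) where
  circle : Fin d → ClosedCurve o
  arc : Fin l → ProperArc o
  disjoint_circles : Pairwise fun i j => Disjoint ((circle i).nbhd 2) ((circle j).nbhd 2)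
  disjoint_arcs : Pairwise fun i j => Disjoint ((arc i).nbhd 2) ((arc j).nbhd 2)
  disjoint_circle_arc : ∀ i j, Disjoint ((circle i).nbhd 2) ((arc j).nbhd 2)

namespace CurveSystem

variable {o : SurfaceOrientation S} {d l : ℕ} (C : CurveSystem o d l)

/-- The parametrisation of the `i`-th curve; it is used on `[0,1]`. -/
def curve : Fin d ⊕ Fin l → ℝ → S
  | .inl i, t => (C.circle i).tube t 0
  | .inr i, t => (C.arc i).tube t 0

/-- The union of the closed curves. -/
def circles : Set S := {x | ∃ i t, (C.circle i).tube t 0 = x}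

/-- The union of all curves and arcs. -/
def support : Set S := {x | ∃ i, ∃ t ∈ Icc (0 : ℝ) 1, C.curve i t = x}

/-- The union of the open tubes of radius one about the circles. -/
def circleNbhd : Set S := {x | ∃ i, x ∈ (C.circle i).nbhd 1}

/-- The union of the open tubes of radius one about the arcs. -/
def arcNbhd : Set S := {x | ∃ i, x ∈ (C.arc i).nbhd 1}

end CurveSystem

/-! ## The sutured manifold of a pair of curve systems -/

/-- The closed disk `D²`. -/
abbrev Disk : Type := Metric.closedBall (0 : ℂ) 1

/-- The point `exp (2 π i t)` of the boundary of the disk. -/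
def Disk.bdry (t : ℝ) : Disk :=
  ⟨Complex.exp (2 * Real.pi * t * Complex.I), by
    rw [mem_closedBall_zero_iff]
    have := Complex.norm_exp_ofReal_mul_I (2 * Real.pi * t)
    push_cast at this
    exact this.le⟩

/-- The interval `[-1, 1]`. -/
abbrev Interval : Type := Icc (-1 : ℝ) 1

section Glue

variable {o : SurfaceOrientation S} {d la lb : ℕ}
  (A : CurveSystem o d la) (B : CurveSystem o d lb)

/-- The pieces: `S × [-1,1]` and, for each closed curve of the two systems, a 3-dimensional
2-handle `D² × [-1,1]`. -/
abbrev Pieces (S : Type) (d : ℕ) : Type :=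
  (S × Interval) ⊕ ((Fin d × Disk × Interval) ⊕ (Fin d × Disk × Interval))

/-- The attaching relation: the handle of a closed curve of `A` is attached to `S × {-1}`, and
the handle of a closed curve of `B` to `S × {1}`, along the tube of radius one of the curve. -/
inductive Glue : Pieces S d → Pieces S d → Prop
  | lower (i : Fin d) (t : ℝ) (s : Interval) :
      Glue (.inr (.inl (i, Disk.bdry t, s))) (.inl ((A.circle i).tube t s, ⟨-1, by simp⟩))
  | upper (i : Fin d) (t : ℝ) (s : Interval) :
      Glue (.inr (.inr (i, Disk.bdry t, s))) (.inl ((B.circle i).tube t s, ⟨1, by simp⟩))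

/-- The 3-manifold obtained from `S × [-1,1]` by attaching 2-handles along the closed curves of
`A` in `S × {-1}` and along the closed curves of `B` in `S × {1}`. -/
def Manifold : Type := Quot (Glue A B)

instance : TopologicalSpace (Manifold A B) := inferInstanceAs (TopologicalSpace (Quot _))

/-- The projection from the pieces to the glued manifold. -/
def Manifold.mk (p : Pieces S d) : Manifold A B := Quot.mk _ p

/-- The inclusion of the Heegaard surface as `S × {0}`. -/
def surfaceInclusion (x : S) : Manifold A B := Manifold.mk A B (.inl (x, ⟨0, by simp⟩))

/-- The part `R₋` of the boundary: the result of surgering `S × {-1}` along the circles of `A`.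
The rest of the boundary consists of `R₊` and of the annuli `∂S × [-1,1]` about the sutures
`∂S × {0}`. -/
def Rminus : Set (Manifold A B) :=
  (fun x => Manifold.mk A B (.inl (x, ⟨-1, by simp⟩))) '' A.circleNbhdᶜ ∪
    {p | ∃ i u, ∃ s : Interval, ((s : ℝ) = -1 ∨ (s : ℝ) = 1) ∧
      p = Manifold.mk A B (.inr (.inl (i, u, s)))}

/-- The part `R₊` of the boundary: the result of surgering `S × {1}` along the circles of `B`. -/
def Rplus : Set (Manifold A B) :=
  (fun x => Manifold.mk A B (.inl (x, ⟨1, by simp⟩))) '' B.circleNbhdᶜ ∪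
    {p | ∃ i u, ∃ s : Interval, ((s : ℝ) = -1 ∨ (s : ℝ) = 1) ∧
      p = Manifold.mk A B (.inr (.inr (i, u, s)))}

/-- Cutting each component of the surface `R` along the open tubular neighbourhood `N` of a
family of arcs yields a closed disk. -/
def CutsIntoDisks {X : Type} [TopologicalSpace X] (R N : Set X) : Prop :=
  ∀ p ∈ R, Nonempty (↥(connectedComponentIn R p \ N) ≃ₜ Disk)

/-- A crossing of `A` and `B`: an intersection point of the `i`-th curve of `A` at time `t` and
the `j`-th curve of `B` at time `u`. -/
structure Crossing where
  i : Fin d ⊕ Fin la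
  j : Fin d ⊕ Fin lb
  t : ℝ
  u : ℝ
  ht : t ∈ Ico (0 : ℝ) 1
  hu : u ∈ Ico (0 : ℝ) 1
  meet : A.curve i t = B.curve j u

end Glue

/-- An ordered, oriented, based, extended sutured Heegaard diagram on `S`, balanced with `d`
closed curves on both sides: `α` consists of the curves `α₁, …, α_d` and of a cut system of `la`
arcs of `(S, α)`; `β` consists of `β₁, …, β_d` and of a cut system of `lb` arcs of `(S, β)`. -/
structure HeegaardDiagram (o : SurfaceOrientation S) (d la lb : ℕ) where
  α : CurveSystem o d la
  β : CurveSystem o d lb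
  transverse : ∀ i j, ∀ t ∈ Icc (0 : ℝ) 1, ∀ u ∈ Icc (0 : ℝ) 1, α.curve i t = β.curve j u →
    (𝓡∂ 2).IsInteriorPoint (α.curve i t) ∧
    o.area (α.curve i t) (velocity (α.curve i) t) (velocity (β.curve j) u) ≠ 0
  finite_crossings : Finite (Crossing α β)
  basepoint_α : ∀ i, (α.circle i).tube 0 0 ∉ β.support
  basepoint_β : ∀ i, (β.circle i).tube 0 0 ∉ α.support
  balanced_α : ∀ x ∉ α.circles,
    ∃ y ∈ connectedComponentIn α.circlesᶜ x, (𝓡∂ 2).IsBoundaryPoint y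
  balanced_β : ∀ x ∉ β.circles,
    ∃ y ∈ connectedComponentIn β.circlesᶜ x, (𝓡∂ 2).IsBoundaryPoint y
  cut_α : CutsIntoDisks (Rminus α β)
    ((fun x => Manifold.mk α β (.inl (x, ⟨-1, by simp⟩))) '' α.arcNbhd)
  cut_β : CutsIntoDisks (Rplus α β)
    ((fun x => Manifold.mk α β (.inl (x, ⟨1, by simp⟩))) '' β.arcNbhd)

namespace HeegaardDiagram

variable {o : SurfaceOrientation S} {d la lb : ℕ} (D : HeegaardDiagram o d la lb)

/-- The 3-manifold underlying the sutured manifold presented by the diagram. -/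
abbrev manifold : Type := Manifold D.α D.β

/-- The crossings of the diagram. -/
abbrev Cr : Type := Crossing D.α D.β

instance : Fintype D.Cr := @Fintype.ofFinite _ D.finite_crossings

/-- The sign `m_x` of a crossing: positive iff (tangent to `α`, tangent to `β`) is a positively
oriented basis. -/
def crossingSign (x : D.Cr) : SignType :=
  SignType.sign (o.area (D.α.curve x.i x.t) (velocity (D.α.curve x.i) x.t)
    (velocity (D.β.curve x.j) x.u))

open Classical in
/-- The crossings along the `i`-th `α`-curve or arc, in the order met from its base point. -/
def alongα (i : Fin d ⊕ Fin la) : List D.Cr :=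
  (Finset.univ.filter fun x : D.Cr => x.i = i).toList.insertionSort fun x y => x.t ≤ y.t

open Classical in
/-- The crossings along the `j`-th `β`-curve or arc, in the order met from its base point. -/
def alongβ (j : Fin d ⊕ Fin lb) : List D.Cr :=
  (Finset.univ.filter fun x : D.Cr => x.j = j).toList.insertionSort fun x y => x.u ≤ y.u

/-- `x` precedes `y` in the total order of the crossings along the ordered `α`-curves. -/
def Beforeα (x y : D.Cr) : Prop := toLex x.i < toLex y.i ∨ x.i = y.i ∧ x.t < y.t

/-- `x` precedes `y` in the total order of the crossings along the ordered `β`-curves. -/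
def Beforeβ (x y : D.Cr) : Prop := toLex x.j < toLex y.j ∨ x.j = y.j ∧ x.u < y.u

/-! ### Dual classes -/

/-- A smooth loop in the interior of the surface, transverse to all `β`-curves and `β`-arcs. -/
structure TransverseLoop where
  toFun : ℝ → S
  smooth : ContMDiff 𝓘(ℝ, ℝ) (𝓡∂ 2) ∞ toFun
  periodic : ∀ t, toFun (t + 1) = toFun t
  interior : ∀ t, (𝓡∂ 2).IsInteriorPoint (toFun t)
  transverse : ∀ t, ∀ j, ∀ u ∈ Icc (0 : ℝ) 1, toFun t = D.β.curve j u →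
    o.area (toFun t) (velocity toFun t) (velocity (D.β.curve j) u) ≠ 0
  finite_meet : ∀ j, {p : ℝ × ℝ | p.1 ∈ Ico (0 : ℝ) 1 ∧ p.2 ∈ Ico (0 : ℝ) 1 ∧
    toFun p.1 = D.β.curve j p.2}.Finite

/-- The algebraic intersection number `c · β_j`. -/
def TransverseLoop.inter (c : D.TransverseLoop) (j : Fin d ⊕ Fin lb) : ℤ :=
  ∑ p ∈ (c.finite_meet j).toFinset,
    (SignType.sign (o.area (c.toFun p.1) (velocity c.toFun p.1)
      (velocity (D.β.curve j) p.2)) : ℤ)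

/-- The class in `H₁(M)` of a loop in the Heegaard surface, for a space `M` identified with the
manifold of the diagram. -/
def TransverseLoop.homologyClass {M : Type} [TopologicalSpace M] (e : D.manifold ≃ₜ M)
    (c : D.TransverseLoop) : H1 M :=
  loopClass (M := M)
    ⟨fun t => e (surfaceInclusion D.α D.β (c.toFun t)), e.continuous.comp
      ((continuous_quot_mk.comp
        (continuous_inl.comp (Continuous.prodMk_left _))).comp c.smooth.continuous)⟩
    (congrArg (fun x => e (surfaceInclusion D.α D.β x)) (by simpa using (c.periodic 0).symm))

/-- `h j = β*_j` for all `j`: the class `h j` is represented by a loop in the Heegaard surface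
whose algebraic intersection number with `β_k` is `δ_{jk}`. Hence it is the image in `H₁(M)` of
the basis Poincaré dual to the compressing disks (and products arc × interval) of the `β_k`. -/
def IsDualFamily {M : Type} [TopologicalSpace M] (e : D.manifold ≃ₜ M)
    (h : Fin d ⊕ Fin lb → H1 M) : Prop :=
  ∀ j, ∃ c : D.TransverseLoop,
    (∀ k, c.inter D k = if k = j then 1 else 0) ∧ c.homologyClass D e = h j

/-- The word `ᾱ_i` in the free group on the symbols `β*_j`. -/
def word (i : Fin d ⊕ Fin la) : FreeGroup (Fin d ⊕ Fin lb) :=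
  ((D.alongα i).map fun x => FreeGroup.of x.j ^ (D.crossingSign x : ℤ)).prod

end HeegaardDiagram

end Surface

/-! ## Fox calculus -/

section Fox

variable {ι : Type} [DecidableEq ι]

/-- Left multiplication of the free group on the additive group of its integral group ring. -/
def foxAction : FreeGroup ι →* MulAut (Multiplicative (MonoidAlgebra ℤ (FreeGroup ι))) where
  toFun w :=
    { toFun := fun x => .ofAdd (MonoidAlgebra.of ℤ _ w * x.toAdd)
      invFun := fun x => .ofAdd (MonoidAlgebra.of ℤ _ w⁻¹ * x.toAdd)
      left_inv := fun x => by
        simp only [toAdd_ofAdd, ← mul_assoc, ← map_mul, inv_mul_cancel, map_one,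
          one_mul, ofAdd_toAdd]
      right_inv := fun x => by
        simp only [toAdd_ofAdd, ← mul_assoc, ← map_mul, mul_inv_cancel, map_one,
          one_mul, ofAdd_toAdd]
      map_mul' := fun x y => by simp only [toAdd_mul, mul_add, ofAdd_add] }
  map_one' := by
    ext1 x
    change Multiplicative.ofAdd (MonoidAlgebra.of ℤ (FreeGroup ι) 1 * x.toAdd) = x
    rw [map_one, one_mul, ofAdd_toAdd]
  map_mul' u v := by
    ext1 x
    change Multiplicative.ofAdd (MonoidAlgebra.of ℤ (FreeGroup ι) (u * v) * x.toAdd) =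
      Multiplicative.ofAdd (MonoidAlgebra.of ℤ _ u * (MonoidAlgebra.of ℤ _ v * x.toAdd))
    rw [map_mul (MonoidAlgebra.of ℤ (FreeGroup ι)), mul_assoc]

/-- The homomorphism `w ↦ (∂w/∂x_j, w)` to the semidirect product `ℤ[F] ⋊ F`. -/
def foxHom (j : ι) : FreeGroup ι →*
    Multiplicative (MonoidAlgebra ℤ (FreeGroup ι)) ⋊[foxAction] FreeGroup ι :=
  FreeGroup.lift fun i => ⟨.ofAdd (if i = j then 1 else 0), FreeGroup.of i⟩

/-- The Fox derivative `∂w/∂x_j ∈ ℤ[F]` of an element `w` of the free group `F`. -/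
def fox (j : ι) (w : FreeGroup ι) : MonoidAlgebra ℤ (FreeGroup ι) :=
  (foxHom j w).left.toAdd

theorem fox_of (i j : ι) : fox j (FreeGroup.of i) = if i = j then 1 else 0 := by
  simp [fox, foxHom]

theorem foxHom_right (j : ι) (w : FreeGroup ι) : (foxHom j w).right = w := by
  have : SemidirectProduct.rightHom.comp (foxHom j) = MonoidHom.id (FreeGroup ι) := by
    ext i; simp [foxHom]
  exact DFunLike.congr_fun this w

theorem fox_mul (j : ι) (u v : FreeGroup ι) :
    fox j (u * v) = fox j u + MonoidAlgebra.of ℤ _ u * fox j v := by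
  rw [fox, map_mul, SemidirectProduct.mul_left, foxHom_right]
  rfl

end Fox

/-! ## The Hopf superalgebra `H_n`, its relative integral and its cointegral -/

section Hopf

variable (n : ℕ) [NeZero n]

/-- The Hopf algebra `B = ℂ[K^{±1}]/(K^n - 1)`, the group algebra of `ℤ/n`. -/
abbrev Bn : Type := MonoidAlgebra ℂ (Multiplicative (ZMod n))

/-- The algebra `H_n = B[X]/(X²)`, generated by `K^{±1}` and `X` with `KX = XK`, `X² = 0`,
`K^n = 1`; here `|K| = 0` and `|X| = 1`. -/
abbrev Hn : Type := DualNumber (Bn n)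

/-- The group `G(B*)` of algebra maps `B → ℂ` under convolution. -/
abbrev GBdual : Type := WithConv (Bn n →ₐ[ℂ] ℂ)

/-- The element `K^a` of `B`. -/
def Kpow (a : ZMod n) : Bn n := MonoidAlgebra.of ℂ _ (Multiplicative.ofAdd a)

/-- Index set of the homogeneous basis `K^a X^e` of `H_n`; the parity of `K^a X^e` is `e`. -/
abbrev Idx : Type := ZMod n × Fin 2

/-- The basis element `K^a X^e` of `H_n`. -/
def bas (b : Idx n) : Hn n := TrivSqZeroExt.inl (Kpow n b.1) * DualNumber.eps ^ (b.2 : ℕ)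

/-- The coordinate functional of `H_n` dual to `K^a X^e`. -/
def coord (b : Idx n) : Hn n →ₗ[ℂ] ℂ where
  toFun h := 
    if b.2 = 0 then h.fst.coeff (Multiplicative.ofAdd b.1)
    else h.snd.coeff (Multiplicative.ofAdd b.1)
  map_add' h k := by split_ifs <;> simp
  map_smul' r h := by split_ifs <;> simp

/-- The linear map on `H_n` with prescribed values on the basis. -/
def ofBasis {V : Type} [AddCommGroup V] [Module ℂ V] (f : Idx n → V) : Hn n →ₗ[ℂ] V :=
  ∑ b : Idx n, (coord n b).smulRight (f b)

/-- The comultiplication: `Δ(K^a) = K^a ⊗ K^a` and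
`Δ(K^a X) = (K^a ⊗ K^a)(K ⊗ X + X ⊗ 1) = K^{a+1} ⊗ K^a X + K^a X ⊗ K^a`. -/
def comul : Hn n →ₗ[ℂ] Hn n ⊗[ℂ] Hn n :=
  ofBasis n fun b =>
    if b.2 = 0 then bas n (b.1, 0) ⊗ₜ bas n (b.1, 0)
    else bas n (b.1 + 1, 0) ⊗ₜ bas n (b.1, 1) + bas n (b.1, 1) ⊗ₜ bas n (b.1, 0)

/-- The counit: `ε(K^a) = 1`, `ε(K^a X) = 0`. -/
def counit : Hn n →ₗ[ℂ] ℂ := ofBasis n fun b => if b.2 = 0 then 1 else 0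

/-- The antipode: `S(K^a) = K^{-a}`, `S(K^a X) = S(X) S(K^a) = -K^{-a-1} X`. -/
def antipode : Hn n →ₗ[ℂ] Hn n :=
  ofBasis n fun b => if b.2 = 0 then bas n (-b.1, 0) else -bas n (-b.1 - 1, 1)

/-- The relative integral `μ = μ_Λ ⊗ id : H_n → B`: `μ(K^a) = 0`, `μ(K^a X) = K^a`. -/
def relIntegral : Hn n →ₗ[ℂ] Bn n := ofBasis n fun b => if b.2 = 0 then 0 else Kpow n b.1

/-- The projection `π_B = ε_Λ ⊗ id : H_n → B`: `π_B(K^a) = K^a`, `π_B(K^a X) = 0`. -/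
def projB : Hn n →ₗ[ℂ] Bn n := ofBasis n fun b => if b.2 = 0 then Kpow n b.1 else 0

/-- The (relative) cointegral `ι = (1/n)(1 + K + ⋯ + K^{n-1}) X`, with `A = ℂ`. -/
def cointegral : Hn n := (n : ℂ)⁻¹ • ∑ a : ZMod n, bas n (a, 1)

/-- The coordinates of the iterated coproduct `Δ^{(k)}(h) ∈ H_n^{⊗ k}` in the basis of `H_n^{⊗ k}`
formed by tensor products of the `K^a X^e`; for `k = 0` it is the counit. -/
def iterComul : List (Idx n) → Hn n →ₗ[ℂ] ℂ
  | [] => counit n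
  | b :: L => iterComul L ∘ₗ (TensorProduct.lid ℂ (Hn n)).toLinearMap ∘ₗ
      (coord n b).rTensor (Hn n) ∘ₗ comul n

/-- Evaluation of algebra maps at `K`, as a homomorphism from `G(B*)` to `ℂ`. -/
def evalK : GBdual n →* ℂ where
  toFun f := f.ofConv (Kpow n 1)
  map_one' := by
    change (1 : GBdual n) (Kpow n 1) = 1
    rw [AlgHom.convOne_apply]
    simp [Kpow]
  map_mul' f g := by
    change (f * g) (Kpow n 1) = f (Kpow n 1) * g (Kpow n 1)
    rw [AlgHom.convMul_apply]
    simp [Kpow]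

end Hopf

/-! ## The scalar `Z` and the Fox matrix -/

namespace HeegaardDiagram

variable {S : Type} [TopologicalSpace S] [ChartedSpace (EuclideanHalfSpace 2) S]
  [IsManifold (𝓡∂ 2) ∞ S]
variable {o : SurfaceOrientation S} {d la lb : ℕ} (D : HeegaardDiagram o d la lb)
  (n : ℕ) [NeZero n]

open Classical in
/-- The sign with which the symmetry of super vector spaces permutes the homogeneous tensor with
basis vector `s x` on the leg `x`, from the order of the legs along the `α`-curves to their order
along the `β`-curves: each pair of odd legs whose order is reversed contributes `-1`. -/
def koszulSign (s : D.Cr → Idx n) : ℂ :=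
  ∏ x : D.Cr, ∏ y : D.Cr, if D.Beforeα x y ∧ D.Beforeβ y x then
    (-1) ^ ((s x).2 * (s y).2 : ℕ) else 1

/-- The tensor of a crossing (the identity or the antipode, according to the sign), applied to
the basis vector `b`. -/
def crossingTensor (x : D.Cr) (b : Idx n) : Hn n :=
  if D.crossingSign x = -1 then antipode n (bas n b) else bas n b

/-- The iterated product along the `j`-th `β`-curve or arc of the vectors on its legs, after
application of the crossing tensors. -/
def productAlong (s : D.Cr → Idx n) (j : Fin d ⊕ Fin lb) : Hn n :=
  ((D.alongβ j).map fun x => D.crossingTensor n x (s x)).prod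

open Classical in
/-- The scalar `Z_{H_n}^ρ` of the diagram, where `ψ j = ρ(β*_j) ∈ G(B*)`: the contraction of the
tensors `Δ^{(k)}(ι)` of the closed `α`-curves, `Δ^{(k)}(i_A(1)) = Δ^{(k)}(1)` of the `α`-arcs,
the tensors of the crossings, `ψ_j ∘ μ ∘ m^{(k)}` of the closed `β`-curves and
`ψ_j ∘ π_B ∘ m^{(k)}` of the `β`-arcs, written as a sum over all labellings of the crossings by
elements of the homogeneous basis of `H_n`. As `A = ℂ`, the group `G(A)` is trivial. -/
def Z (ψ : Fin d ⊕ Fin lb → GBdual n) : ℂ :=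
  ∑ s : D.Cr → Idx n, D.koszulSign n s *
    (∏ i : Fin d, iterComul n ((D.alongα (.inl i)).map s) (cointegral n)) *
    (∏ i : Fin la, iterComul n ((D.alongα (.inr i)).map s) 1) *
    (∏ j : Fin d, (ψ (.inl j)).ofConv (relIntegral n (D.productAlong n s (.inl j)))) *
    (∏ j : Fin lb, (ψ (.inr j)).ofConv (projB n (D.productAlong n s (.inr j))))

end HeegaardDiagram

variable {M : Type} [TopologicalSpace M]

/-- `ρ_K : ℤ[H₁(M)] → ℂ`, the ring homomorphism with `ρ_K(h) = ρ(h)(K)` for `h ∈ H₁(M)`. -/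
def rhoK (n : ℕ) [NeZero n] (ρ : Multiplicative (H1 M) →* GBdual n) :
    MonoidAlgebra ℤ (Multiplicative (H1 M)) →+* ℂ :=
  (MonoidAlgebra.lift ℤ ℂ (Multiplicative (H1 M)) ((evalK n).comp ρ)).toRingHom

/-- The image in `ℤ[H₁(M)]` of an element of `ℤ[F]`, where the free generators `x_j` of `F` are
sent to the classes `h j`. -/
def toHomologyRing {ι : Type} (h : ι → H1 M) :
    MonoidAlgebra ℤ (FreeGroup ι) →+* MonoidAlgebra ℤ (Multiplicative (H1 M)) :=
  MonoidAlgebra.mapDomainRingHom ℤ (FreeGroup.lift fun j => Multiplicative.ofAdd (h j))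

end

end Sutured

/-!
The identity has a topological half, which is where the geometry of the Heegaard diagram enters,
and an algebraic half, which is an expansion of the scalar `Z` over states.

*Topology.* Evaluated at `K^a`, the representation `ρ` sends the word read along a closed
`α`-curve to `1`. This follows from the relation `∑ m_x β*_{j(x)} = 0` in `H₁(M)`, summed over the
crossings of the curve (`HeegaardDiagram.sum_crossings_eq_zero`). To prove it without computing
`H₁(M)`, paths are measured in the group of singular 1-chains modulo boundaries, which contains
`H₁(M)`. The surface `R₊` is cut into disks by the `β`-arcs, so outside the tubes of the `β`-curves
the class of a path is the difference of the values of a potential at its end points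
(`CutsIntoDisks.exists_potential`). Extending this potential into the tubes along the normal
directions, one gets for each curve `β_k` a class `E_k`, the defect of the potential across `β_k`,
and every transverse loop `c` of `Σ` represents `∑ m_x E_{k(x)}`, summed over its crossings with
the `β`-curves (`CurveSystem.seg_loop_eq_sum`). Applied to a loop dual to `β_j` this gives
`E_j = β*_j` (`HeegaardDiagram.toChains_dual`); applied to `α_i`, which bounds a disk in its
2-handle, it gives the relation.

*Algebra.* The term `K^a X` of the cointegral has iterated coproduct
`∑ K^{a+1} ⊗ ⋯ ⊗ K^{a+1} ⊗ K^a X ⊗ K^a ⊗ ⋯ ⊗ K^a`, so `Z` is a sum over the choices, for each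
closed `α`-curve, of a power `a` and of a crossing carrying the odd factor
(`HeegaardDiagram.prod_iterComul`). Composed with an algebra map `B → ℂ`, the maps `π_B` and `μ`
become the two components of a homomorphism from `H_n` to the dual numbers, so the tensors of the
`β`-curves are products of scalars, one for each crossing, and they vanish unless each closed
`β`-curve carries exactly one odd factor and each `β`-arc none
(`HeegaardDiagram.relIntegral_productAlong`, `HeegaardDiagram.projB_productAlong`). Hence the
chosen crossings are matched with the closed `β`-curves by a permutation, whose sign is the Koszul
sign (`HeegaardDiagram.koszulSign_eq_sign`). Along `α_i` the scalars multiply to the value of the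
word at `K^a`, which is `1` by the relation above, times the value of the prefix before the chosen
crossing, times `-ρ(β*_j)(K)⁻¹` if that crossing is negative, because
`S(K^a X) = -K^{-a-1} X` (`HeegaardDiagram.IsTransversal.prod_legValue`). This is the term of the
Fox derivative at that crossing (`fox_word`), the `n` values of `a` cancel the factor `1/n`, and
the sum over the permutations is the Leibniz expansion of the determinant
(`HeegaardDiagram.Z_eq_det`).
-/

namespace Sutured

noncomputable section

open scoped TensorProduct
open CategoryTheory Set

/-! ### One-chains modulo boundaries -/

section Chains

open scoped Simplicial

/-- The group of singular 1-chains of `M` modulo boundaries. It contains `H₁(M)`, and unlike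
`H₁(M)` it has a class for every path, additive under concatenation. -/
abbrev Chains1 (M : Type) [TopologicalSpace M] : ModuleCat.{0} ℤ := (singularChains M).opcycles 1

variable {M : Type} [TopologicalSpace M]

/-- The class of a singular 1-simplex modulo boundaries. -/
def simplexClass (f : C(stdSimplex ℝ (Fin 2), M)) : Chains1 M :=
  ((TopCat.toSSet.obj (TopCat.of M)).ιChainComplex
      ((TopCat.toSSetObjEquiv (TopCat.of M) (.op ⦋1⦌)).symm f) ≫
    (singularChains M).pOpcycles 1 : ModuleCat.of ℤ ℤ ⟶ _) (1 : ℤ)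

/-- The relation given by the boundary of a 2-simplex. -/
theorem boundary_eq_zero (X : SSet.{0}) (x : X _⦋2⦌) :
    (X.ιChainComplex (X.δ 0 x) ≫ (X.chainComplex (ModuleCat.of ℤ ℤ)).pOpcycles 1 :
        ModuleCat.of ℤ ℤ ⟶ _) (1 : ℤ) +
      (X.ιChainComplex (X.δ 2 x) ≫ (X.chainComplex (ModuleCat.of ℤ ℤ)).pOpcycles 1 :
        ModuleCat.of ℤ ℤ ⟶ _) (1 : ℤ) =
      (X.ιChainComplex (X.δ 1 x) ≫ (X.chainComplex (ModuleCat.of ℤ ℤ)).pOpcycles 1 :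
        ModuleCat.of ℤ ℤ ⟶ _) (1 : ℤ) := by
  have h := congrArg (fun φ => φ ≫ (X.chainComplex (ModuleCat.of ℤ ℤ)).pOpcycles 1)
    ((SSet.ιChainComplex_d X (ModuleCat.of ℤ ℤ) x).trans (Fin.sum_univ_three _))
  simp only [Category.assoc, HomologicalComplex.d_pOpcycles, Limits.comp_zero,
    Preadditive.add_comp, Preadditive.zsmul_comp] at h
  have h4 := congrArg (fun φ => φ.hom (1 : ℤ)) h
  simp at h4
  rw [← sub_eq_zero]
  refine Eq.trans ?_ h4.symm
  simp
  abel

theorem simplexClass_boundary (f : C(stdSimplex ℝ (Fin 3), M)) :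
    simplexClass (f.comp ⟨stdSimplex.map (SimplexCategory.δ (n := 1) 0),
        stdSimplex.continuous_map _⟩) +
      simplexClass (f.comp ⟨stdSimplex.map (SimplexCategory.δ (n := 1) 2),
        stdSimplex.continuous_map _⟩) =
      simplexClass (f.comp ⟨stdSimplex.map (SimplexCategory.δ (n := 1) 1),
        stdSimplex.continuous_map _⟩) :=
  boundary_eq_zero (TopCat.toSSet.obj (TopCat.of M))
    ((TopCat.toSSetObjEquiv (TopCat.of M) (.op ⦋2⦌)).symm f)

/-- The inclusion of `H₁(M)` into the 1-chains modulo boundaries. -/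
def H1.toChains : H1 M →+ Chains1 M := ((singularChains M).homologyι 1).hom.toAddMonoidHom

theorem H1.toChains_injective : Function.Injective (H1.toChains (M := M)) :=
  (ModuleCat.mono_iff_injective ((singularChains M).homologyι 1)).1 inferInstance

theorem H1.toChains_loopClass (c : C(ℝ, M)) (hc : c 0 = c 1) :
    H1.toChains (loopClass c hc) = simplexClass (c.comp ⟨fun p : stdSimplex ℝ (Fin 2) => p.1 1,
      (continuous_apply 1).comp continuous_subtype_val⟩) := by
  have : ((singularChains M).liftCycles
      ((TopCat.toSSet.obj (TopCat.of M)).ιChainComplex (pathSimplex c))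
      0 (by simp) (pathSimplex_cycle c hc) ≫
    (singularChains M).homologyπ 1) ≫ (singularChains M).homologyι 1 =
    (TopCat.toSSet.obj (TopCat.of M)).ιChainComplex (pathSimplex c) ≫
    (singularChains M).pOpcycles 1 := by
    rw [Category.assoc, HomologicalComplex.homology_π_ι, ← Category.assoc]
    congr 1
    exact HomologicalComplex.liftCycles_i _ _ _ _ _
  exact congrArg (fun φ : ModuleCat.of ℤ ℤ ⟶ Chains1 M => φ.hom (1 : ℤ)) this

end Chains

/-! ### Classes of images of segments -/

section Segments

variable {M : Type} [TopologicalSpace M]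

open Classical in
/-- The class, modulo boundaries, of the image under `F` of the straight segment from `p` to `q`
(zero if `F` is not continuous along this segment). -/
def seg {E : Type*} [AddCommGroup E] [Module ℝ E] (F : E → M) (p q : E) : Chains1 M :=
  if h : Continuous fun x : stdSimplex ℝ (Fin 2) => F (x.1 0 • p + x.1 1 • q) then
    simplexClass ⟨_, h⟩ else 0

theorem seg_congr {E E' : Type*} [AddCommGroup E] [Module ℝ E] [AddCommGroup E']
    [Module ℝ E'] {F : E → M} {p q : E} {G : E' → M} {p' q' : E'}
    (h : ∀ a b : ℝ, 0 ≤ a → 0 ≤ b → a + b = 1 →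
      F (a • p + b • q) = G (a • p' + b • q')) :
    seg F p q = seg G p' q' := by
  have : (fun x : stdSimplex ℝ (Fin 2) => F (x.1 0 • p + x.1 1 • q)) =
      fun x : stdSimplex ℝ (Fin 2) => G (x.1 0 • p' + x.1 1 • q') := by
    funext x
    exact h _ _ (x.2.1 0) (x.2.1 1) (by simpa [Fin.sum_univ_two] using x.2.2)
  unfold seg
  by_cases h' : Continuous fun x : stdSimplex ℝ (Fin 2) => G (x.1 0 • p' + x.1 1 • q')
  · rw [dif_pos h', dif_pos (this ▸ h')]
    congr 2
  · rw [dif_neg h', dif_neg (this ▸ h')]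

theorem sum_map_smul {E : Type*} [AddCommGroup E] [Module ℝ E] {m n : ℕ} (f : Fin m → Fin n)
    (x : stdSimplex ℝ (Fin m)) (v : Fin n → E) :
    ∑ j, (stdSimplex.map f x).1 j • v j = ∑ k, x.1 k • v (f k) := by
  have h : ∀ j, (stdSimplex.map f x).1 j = ∑ k with f k = j, x.1 k := fun j =>
    FunOnFinite.linearMap_apply_apply ℝ ℝ f x.1 j
  simp only [h, Finset.sum_smul]
  rw [← Finset.sum_fiberwise Finset.univ f fun k => x.1 k • v (f k)]
  refine Finset.sum_congr rfl fun j _ => Finset.sum_congr rfl fun k hk => ?_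
  rw [(Finset.mem_filter.1 hk).2]

/-- The classes of the sides of a triangle in a convex set. -/
theorem seg_add_seg {E : Type*} [AddCommGroup E] [Module ℝ E] [TopologicalSpace E]
    [IsTopologicalAddGroup E] [ContinuousSMul ℝ E] {F : E → M} {K : Set E} (hK : Convex ℝ K)
    (hF : ContinuousOn F K) {p q r : E} (hp : p ∈ K) (hq : q ∈ K) (hr : r ∈ K) :
    seg F p q + seg F q r = seg F p r := by
  have hcont : ∀ {n : ℕ} (v : Fin n → E), (∀ i, v i ∈ K) →
      Continuous fun x : stdSimplex ℝ (Fin n) => F (∑ i, x.1 i • v i) := by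
    intro n v hv
    refine hF.comp_continuous ?_ fun x => hK.sum_mem (fun i _ => x.2.1 i) x.2.2 fun i _ => hv i
    exact continuous_finsetSum _ fun i _ =>
      ((continuous_apply i).comp continuous_subtype_val).smul continuous_const
  have hseg : ∀ {p q : E}, p ∈ K → q ∈ K → ∃ h : Continuous fun x : stdSimplex ℝ (Fin 2) =>
      F (x.1 0 • p + x.1 1 • q), seg F p q = simplexClass ⟨_, h⟩ := by
    intro p q hp hq
    have h : Continuous fun x : stdSimplex ℝ (Fin 2) => F (x.1 0 • p + x.1 1 • q) := by
      have := hcont ![p, q] (by intro i; fin_cases i <;> assumption)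
      simpa [Fin.sum_univ_two] using this
    exact ⟨h, dif_pos h⟩
  obtain ⟨h1, e1⟩ := hseg hp hq
  obtain ⟨h2, e2⟩ := hseg hq hr
  obtain ⟨h3, e3⟩ := hseg hp hr
  have h := simplexClass_boundary
    ⟨_, hcont ![p, q, r] (by intro i; fin_cases i <;> assumption)⟩
  rw [e1, e2, e3, add_comm]
  convert h using 3
  all_goals
    ext x
    refine Eq.trans ?_ (congrArg F (sum_map_smul _ x ![p, q, r])).symm
    simp only [Fin.sum_univ_two]
    rfl

theorem seg_self {E : Type*} [AddCommGroup E] [Module ℝ E] (F : E → M) (p : E) :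
    seg F p p = 0 := by
  have h := seg_add_seg (F := fun _ : ℝ => F p) (K := univ) convex_univ continuousOn_const
    (mem_univ 0) (mem_univ 0) (mem_univ 0)
  rw [add_eq_left] at h
  rw [← h]
  exact seg_congr fun a b _ _ hab => by rw [← add_smul, hab, one_smul]

/-- Modulo boundaries, the image of a curve in a convex set is the image of the segment between
its end points, by the straight-line homotopy. -/
theorem seg_comp {E : Type*} [AddCommGroup E] [Module ℝ E] [TopologicalSpace E]
    [IsTopologicalAddGroup E] [ContinuousSMul ℝ E] {F : E → M} {K : Set E} (hK : Convex ℝ K)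
    (hF : ContinuousOn F K) {γ : ℝ → E} {u v : ℝ} (huv : u ≤ v) (hγ : ContinuousOn γ (Icc u v))
    (hγK : MapsTo γ (Icc u v) K) :
    seg (F ∘ γ) u v = seg F (γ u) (γ v) := by
  rcases huv.eq_or_lt with rfl | huv
  · rw [seg_self, seg_self]
  have hvu : v - u ≠ 0 := sub_ne_zero.2 huv.ne'
  let ℓ : ℝ → E := fun x => ((v - x) / (v - u)) • γ u + ((x - u) / (v - u)) • γ v
  have hℓ : Continuous ℓ := by fun_prop
  have hu : u ∈ Icc u v := left_mem_Icc.2 huv.le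
  have hv : v ∈ Icc u v := right_mem_Icc.2 huv.le
  have hℓu : ℓ u = γ u := by simp [ℓ, div_self hvu]
  have hℓv : ℓ v = γ v := by simp [ℓ, div_self hvu]
  have hℓK : MapsTo ℓ (Icc u v) K := fun x hx => by
    refine hK (hγK hu) (hγK hv) (div_nonneg (sub_nonneg.2 hx.2) (sub_nonneg.2 huv.le))
      (div_nonneg (sub_nonneg.2 hx.1) (sub_nonneg.2 huv.le)) ?_
    field_simp
    ring
  -- the two triangles of the square `[u, v] × [0, 1]`, on which the homotopy `H` is defined, relate
  -- its four sides; the vertical sides are constant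
  let H : ℝ × ℝ → E := fun z => (1 - z.2) • ℓ z.1 + z.2 • γ z.1
  let R : Set (ℝ × ℝ) := Icc u v ×ˢ Icc 0 1
  have hR : Convex ℝ R := (convex_Icc u v).prod (convex_Icc 0 1)
  have hH : ContinuousOn (F ∘ H) R := by
    refine hF.comp ?_ fun z hz => hK (hℓK hz.1) (hγK hz.1) (sub_nonneg.2 hz.2.2) hz.2.1 (by ring)
    refine ContinuousOn.add ?_ ?_
    · fun_prop
    · exact continuousOn_snd.smul (hγ.comp continuousOn_fst fun z hz => hz.1)
  have h0 : (0 : ℝ) ∈ Icc (0 : ℝ) 1 := by simp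
  have h1 : (1 : ℝ) ∈ Icc (0 : ℝ) 1 := by simp
  have e1 := seg_add_seg hR hH (p := (u, 0)) (q := (u, 1)) (r := (v, 1)) ⟨hu, h0⟩ ⟨hu, h1⟩ ⟨hv, h1⟩
  have e2 := seg_add_seg hR hH (p := (u, 0)) (q := (v, 0)) (r := (v, 1)) ⟨hu, h0⟩ ⟨hv, h0⟩ ⟨hv, h1⟩
  have s1 : seg (F ∘ H) (u, 0) (u, 1) = 0 := by
    rw [← seg_self F (γ u)]
    refine seg_congr fun a b _ _ hab => ?_
    have : a * u + b * u = u := by rw [← add_mul, hab, one_mul]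
    simp [H, this, hℓu, ← add_smul, hab]
  have s2 : seg (F ∘ H) (v, 0) (v, 1) = 0 := by
    rw [← seg_self F (γ v)]
    refine seg_congr fun a b _ _ hab => ?_
    have : a * v + b * v = v := by rw [← add_mul, hab, one_mul]
    simp [H, this, hℓv, ← add_smul, hab]
  have s3 : seg (F ∘ H) (u, 1) (v, 1) = seg (F ∘ γ) u v :=
    seg_congr fun a b _ _ hab => by simp [H, hab]
  have s4 : seg (F ∘ H) (u, 0) (v, 0) = seg F (γ u) (γ v) :=
    seg_congr fun a b _ _ hab => by
      obtain rfl : a = 1 - b := by linarith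
      simp only [H, ℓ, Function.comp, Prod.smul_mk, Prod.mk_add_mk, smul_eq_mul, mul_zero,
        add_zero, sub_zero, one_smul, zero_smul]
      congr 3
      · field_simp
        ring
      · field_simp
        ring
  rw [s1, s3, zero_add] at e1
  rw [s2, s4, add_zero] at e2
  rw [e1, e2]

/-- The class of a loop in `H₁(M)` is the class of the image of `[0, 1]`. -/
theorem H1.toChains_loopClass_eq_seg (c : C(ℝ, M)) (hc : c 0 = c 1) :
    H1.toChains (loopClass c hc) = seg c 0 1 := by
  rw [H1.toChains_loopClass]
  have : Continuous fun x : stdSimplex ℝ (Fin 2) => c (x.1 0 • (0 : ℝ) + x.1 1 • 1) :=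
    c.continuous.comp <|
      (((continuous_apply 0).comp continuous_subtype_val).smul continuous_const).add
        (((continuous_apply 1).comp continuous_subtype_val).smul continuous_const)
  rw [seg, dif_pos this]
  congr 1
  ext x
  simp

end Segments

/-! ### Local coordinates in a tube -/

section LocalCoordinates

open Filter Topology

variable {S : Type} [TopologicalSpace S] [ChartedSpace (EuclideanHalfSpace 2) S]

/-- The velocity is the derivative in the preferred chart. -/
theorem hasDerivAt_velocity {c : ℝ → S} {τ : ℝ} (hc : MDifferentiableAt 𝓘(ℝ, ℝ) (𝓡∂ 2) c τ) :
    HasDerivAt (extChartAt (𝓡∂ 2) (c τ) ∘ c) (velocity c τ) τ := by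
  have h := hc.hasMFDerivAt.2
  simp only [writtenInExtChartAt, extChartAt_model_space_eq_id, PartialEquiv.refl_symm,
    PartialEquiv.refl_coe, modelWithCornersSelf_coe, range_id, Function.comp_id, id] at h
  obtain ⟨A, hA⟩ : ∃ A : ℝ →L[ℝ] EuclideanSpace ℝ (Fin 2),
      A = mfderiv 𝓘(ℝ, ℝ) (𝓡∂ 2) c τ := ⟨_, rfl⟩
  have h' : HasFDerivAt (extChartAt (𝓡∂ 2) (c τ) ∘ c) A τ := by
    rw [hA]
    exact hasFDerivWithinAt_univ.1 h
  have hv : velocity c τ = A 1 := by rw [hA]; rfl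
  rw [hv]
  exact h'.hasDerivAt

variable [IsManifold (𝓡∂ 2) ∞ S]

/-- By the inverse function theorem, a smooth positively oriented tube `(t, s) ↦ tube t s` is
locally invertible. The `s`-coordinate of a curve crossing the core `t ↦ tube t z.2` decreases
when the crossing (curve, core) is positive and increases when it is negative. -/
theorem exists_local_coordinates (o : SurfaceOrientation S) {tube : ℝ → ℝ → S} {z : ℝ × ℝ}
    (hs : ContMDiffAt 𝓘(ℝ, ℝ × ℝ) (𝓡∂ 2) ∞ (fun p : ℝ × ℝ => tube p.1 p.2) z)
    (hpos : 0 < o.area (tube z.1 z.2) (velocity (fun t => tube t z.2) z.1)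
      (velocity (fun s => tube z.1 s) z.2)) :
    ∃ g : S → ℝ × ℝ, g (tube z.1 z.2) = z ∧
      (∀ᶠ x in 𝓝 (tube z.1 z.2), tube (g x).1 (g x).2 = x ∧ ContinuousAt g x) ∧
      ∀ (c : ℝ → S) (τ : ℝ), c τ = tube z.1 z.2 → MDifferentiableAt 𝓘(ℝ, ℝ) (𝓡∂ 2) c τ →
        ∃ w : ℝ, HasDerivAt (fun u => (g (c u)).2) w τ ∧
          o.area (c τ) (velocity c τ) (velocity (fun t => tube t z.2) z.1) =
            -w * o.area (tube z.1 z.2) (velocity (fun t => tube t z.2) z.1)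
              (velocity (fun s => tube z.1 s) z.2) := by
  -- `T` is the tube read in the chart at `p`; its differential `A` is invertible because `o.area`
  -- is a multiple of the determinant
  set p := tube z.1 z.2 with hp
  set T : ℝ × ℝ → EuclideanSpace ℝ (Fin 2) := fun y => extChartAt (𝓡∂ 2) p (tube y.1 y.2) with hT
  have hTs : ContDiffAt ℝ ∞ T z :=
    ((contMDiffAt_iff_target (f := fun p : ℝ × ℝ => tube p.1 p.2)).1 hs).2.contDiffAt
  have hstrict : HasStrictFDerivAt T (fderiv ℝ T z) z := hTs.hasStrictFDerivAt (by simp)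
  set A := fderiv ℝ T z with hA
  have h1 : A (1, 0) = velocity (fun t => tube t z.2) z.1 := by
    have hd : MDifferentiableAt 𝓘(ℝ, ℝ) (𝓡∂ 2) (fun t => tube t z.2) z.1 := by
      have := (hs.mdifferentiableAt (by simp))
      refine this.comp (I := 𝓘(ℝ, ℝ)) (x := z.1) (f := fun t : ℝ => (t, z.2)) ?_
      exact (DifferentiableAt.mdifferentiableAt (by fun_prop))
    refine HasDerivAt.unique ?_ (hasDerivAt_velocity hd)
    exact hstrict.hasFDerivAt.comp_hasDerivAt (x := z.1) (f := fun t : ℝ => (t, z.2))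
      ((hasDerivAt_id _).prodMk (hasDerivAt_const _ _))
  have h2 : A (0, 1) = velocity (fun s => tube z.1 s) z.2 := by
    have hd : MDifferentiableAt 𝓘(ℝ, ℝ) (𝓡∂ 2) (fun s => tube z.1 s) z.2 := by
      have := (hs.mdifferentiableAt (by simp))
      refine this.comp (I := 𝓘(ℝ, ℝ)) (x := z.2) (f := fun s : ℝ => (z.1, s)) ?_
      exact (DifferentiableAt.mdifferentiableAt (by fun_prop))
    refine HasDerivAt.unique ?_ (hasDerivAt_velocity hd)
    exact hstrict.hasFDerivAt.comp_hasDerivAt (x := z.2) (f := fun s : ℝ => (z.1, s))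
      ((hasDerivAt_const _ _).prodMk (hasDerivAt_id _))
  rw [← h1, ← h2] at hpos ⊢
  have hlin : ∀ a b : ℝ, A (a, b) = a • A (1, 0) + b • A (0, 1) := fun a b => by
    rw [← map_smul, ← map_smul, ← map_add]; simp
  have harea : A (1, 0) 0 * A (0, 1) 1 - A (1, 0) 1 * A (0, 1) 0 ≠ 0 := fun h0 => by
    rw [SurfaceOrientation.area, h0, mul_zero] at hpos
    exact lt_irrefl _ hpos
  have hinj : Function.Injective (A : ℝ × ℝ →ₗ[ℝ] EuclideanSpace ℝ (Fin 2)) := by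
    rw [← LinearMap.ker_eq_bot, LinearMap.ker_eq_bot']
    rintro ⟨a, b⟩ hab
    have hab' : A (a, b) = 0 := hab
    rw [hlin] at hab'
    have e0 := congrFun (congrArg WithLp.ofLp hab') 0
    have e1 := congrFun (congrArg WithLp.ofLp hab') 1
    simp at e0 e1
    have ha : a = 0 := (mul_eq_zero.1 (show a * (A (1, 0) 0 * A (0, 1) 1 -
      A (1, 0) 1 * A (0, 1) 0) = 0 by
        linear_combination A (0, 1) 1 * e0 - A (0, 1) 0 * e1)).resolve_right harea
    have hb : b = 0 := (mul_eq_zero.1 (show b * (A (1, 0) 0 * A (0, 1) 1 -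
      A (1, 0) 1 * A (0, 1) 0) = 0 by
        linear_combination A (1, 0) 0 * e1 - A (1, 0) 1 * e0)).resolve_right harea
    rw [ha, hb]; rfl
  let A' : (ℝ × ℝ) ≃L[ℝ] EuclideanSpace ℝ (Fin 2) :=
    (LinearMap.linearEquivOfInjective _ hinj (by simp)).toContinuousLinearEquiv
  have hA' : (A' : ℝ × ℝ →L[ℝ] EuclideanSpace ℝ (Fin 2)) = A := by ext <;> rfl
  rw [← hA'] at hstrict
  set G := hstrict.localInverse T A' z with hG
  have hTz : T z = extChartAt (𝓡∂ 2) p p := rfl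
  have hchart : ContinuousAt (extChartAt (𝓡∂ 2) p) p := continuousAt_extChartAt p
  refine ⟨fun x => G (extChartAt (𝓡∂ 2) p x), ?_, ?_, ?_⟩
  · exact hstrict.localInverse_apply_image
  · have e1 : ∀ᶠ x in 𝓝 p, T (G (extChartAt (𝓡∂ 2) p x)) = extChartAt (𝓡∂ 2) p x :=
      hchart.eventually hstrict.eventually_right_inverse
    have e2 : ∀ᶠ y in 𝓝 (T z), ContinuousAt G y := by
      filter_upwards [(hstrict.toOpenPartialHomeomorph T).open_target.mem_nhds
        hstrict.image_mem_toOpenPartialHomeomorph_target] with y hy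
      exact (hstrict.toOpenPartialHomeomorph T).continuousAt_symm hy
    have e3 : ∀ᶠ x in 𝓝 p, x ∈ (extChartAt (𝓡∂ 2) p).source := extChartAt_source_mem_nhds p
    have e4 : Tendsto (fun x => G (extChartAt (𝓡∂ 2) p x)) (𝓝 p) (𝓝 z) :=
      hstrict.localInverse_tendsto.comp hchart
    have e5 : ∀ᶠ y in 𝓝 z, tube y.1 y.2 ∈ (extChartAt (𝓡∂ 2) p).source :=
      hs.continuousAt.eventually (extChartAt_source_mem_nhds p)
    filter_upwards [e1, hchart.eventually e2, e3, e4.eventually e5] with x x1 x2 x3 x5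
    exact ⟨(extChartAt (𝓡∂ 2) p).injOn x5 x3 x1,
      x2.comp (continuousAt_extChartAt' x3)⟩
  · intro c τ hcτ hc
    have hd := hasDerivAt_velocity hc
    rw [hcτ] at hd
    have hG' := hstrict.to_localInverse.hasFDerivAt
    have hTc : T z = (extChartAt (𝓡∂ 2) p ∘ c) τ := by rw [hTz, ← hcτ]; rfl
    rw [hTc] at hG'
    have hd2 := hG'.comp_hasDerivAt τ hd
    have hd3 := (hasFDerivAt_snd (𝕜 := ℝ) (E := ℝ) (F := ℝ)).comp_hasDerivAt τ hd2
    refine ⟨_, hd3, ?_⟩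
    have hv : velocity c τ = A (A'.symm (velocity c τ)) := by
      conv_lhs => rw [← A'.apply_symm_apply (velocity c τ)]
      rfl
    change _ = -(A'.symm (velocity c τ)).2 * _
    rw [← Prod.mk.eta (p := A'.symm (velocity c τ)), hlin] at hv
    rw [hcτ, hv]
    simp only [SurfaceOrientation.area, PiLp.add_apply, PiLp.smul_apply, smul_eq_mul]
    rw [← hv]
    ring

end LocalCoordinates

/-! ### Jumps of piecewise constant functions -/

section Jumps

open Filter Topology

/-- If the values on the left and on the right of `τ` agree near `τ`, the function is constant near
`τ`, except possibly at `τ`. -/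
theorem exists_const_of_left_right {A : Type*} {g : ℝ → A} {τ : ℝ}
    (h : ∀ᶠ u in 𝓝[<] τ, ∀ᶠ v in 𝓝[>] τ, g v = g u) : ∃ C, ∀ᶠ u in 𝓝[≠] τ, g u = C := by
  obtain ⟨u₀, hu₀⟩ := h.exists
  refine ⟨g u₀, ?_⟩
  rw [← Set.Iio_union_Ioi, nhdsWithin_union, eventually_sup]
  refine ⟨?_, hu₀⟩
  filter_upwards [h] with u hu
  obtain ⟨v, hv, hv'⟩ := (hu.and hu₀).exists
  exact hv.symm.trans hv'

/-- A function that is constant near each point of an interval, except possibly at the point, has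
the same nearby value at all points. -/
theorem const_of_punctured_const {A : Type*} {g : ℝ → A} {C : ℝ → A} {p q : ℝ} (hpq : p ≤ q)
    (h : ∀ τ ∈ Icc p q, ∀ᶠ u in 𝓝[≠] τ, g u = C τ) : C p = C q := by
  have hloc : IsLocallyConstant fun τ : Icc p q => C τ := by
    rw [IsLocallyConstant.iff_eventually_eq]
    rintro ⟨τ, hτ⟩
    have h1 := eventually_eventually_nhdsWithin.2 (h τ hτ)
    rw [eventually_nhdsWithin_iff] at h1
    filter_upwards [continuous_subtype_val.continuousAt.eventually h1] with ⟨u, hu⟩ hu'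
    by_cases huτ : u = τ
    · subst huτ; rfl
    · have h2 := hu' huτ
      rw [IsOpen.nhdsWithin_eq isOpen_compl_singleton huτ] at h2
      obtain ⟨w, hw, hw'⟩ := ((h2.filter_mono nhdsWithin_le_nhds).and (h u hu)).exists
      exact hw'.symm.trans hw
  have : PreconnectedSpace (Icc p q) := Subtype.preconnectedSpace isPreconnected_Icc
  exact hloc.apply_eq_of_preconnectedSpace ⟨p, left_mem_Icc.2 hpq⟩ ⟨q, right_mem_Icc.2 hpq⟩

/-- The increment of a piecewise constant function is the sum of its jumps. A jump is the difference
of the values on both sides, so that the value at the point itself is irrelevant. -/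
theorem increment_eq_sum_jumps {A : Type*} [AddCommGroup A] {f : ℝ → A} {F : Finset ℝ} {J : ℝ → A}
    (hF : ∀ σ ∈ F, 0 ≤ σ)
    (hJ : ∀ τ ∈ Icc (0 : ℝ) 1, ∀ᶠ u in 𝓝[<] τ, ∀ᶠ v in 𝓝[>] τ,
      f v - f u = if τ ∈ F then J τ else 0) :
    ∃ C, (∀ᶠ u in 𝓝[<] (0 : ℝ), f u = C) ∧
      ∀ᶠ u in 𝓝[<] (1 : ℝ), f u = C + ∑ σ ∈ F with σ < 1, J σ := by
  classical
  -- the sum of the jumps before `t`; it has the same jumps as `f`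
  let N : ℝ → A := fun t => ∑ σ ∈ F with σ < t, J σ
  have hleft : ∀ τ, ∀ᶠ u in 𝓝[<] τ, N u = ∑ σ ∈ F with σ < τ, J σ := fun τ => by
    have : ∀ᶠ u in 𝓝[<] τ, ∀ σ ∈ F, (σ < u ↔ σ < τ) := by
      rw [Finset.eventually_all]
      intro σ _
      by_cases hσ : σ < τ
      · filter_upwards [Ioo_mem_nhdsLT hσ] with u hu
        exact iff_of_true hu.1 hσ
      · filter_upwards [self_mem_nhdsWithin] with u hu
        exact iff_of_false (fun h => hσ (h.trans hu)) hσ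
    filter_upwards [this] with u hu
    exact Finset.sum_congr (Finset.filter_congr hu) fun _ _ => rfl
  have hright : ∀ τ, ∀ᶠ u in 𝓝[>] τ, N u =
      (∑ σ ∈ F with σ < τ, J σ) + if τ ∈ F then J τ else 0 := fun τ => by
    have : ∀ᶠ u in 𝓝[>] τ, ∀ σ ∈ F, (σ < u ↔ σ ≤ τ) := by
      rw [Finset.eventually_all]
      intro σ _
      by_cases hσ : σ ≤ τ
      · filter_upwards [self_mem_nhdsWithin] with u hu
        exact iff_of_true (hσ.trans_lt hu) hσ
      · filter_upwards [Ioo_mem_nhdsGT (not_le.1 hσ)] with u hu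
        exact iff_of_false (not_lt.2 hu.2.le) hσ
    filter_upwards [this] with u hu
    have : (∑ σ ∈ F with σ ≤ τ, J σ) =
        (∑ σ ∈ F with σ < τ, J σ) + ∑ σ ∈ F with τ = σ, J σ := by
      rw [← Finset.sum_union]
      · refine Finset.sum_congr ?_ fun _ _ => rfl
        ext σ
        simp only [Finset.mem_filter, Finset.mem_union, le_iff_lt_or_eq, eq_comm (a := τ)]
        tauto
      · rw [Finset.disjoint_filter]
        rintro σ _ h1 rfl
        exact lt_irrefl _ h1
    refine (Finset.sum_congr (Finset.filter_congr hu) fun _ _ => rfl).trans (this.trans ?_)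
    rw [Finset.filter_eq]
    split_ifs <;> simp
  have hg : ∀ τ ∈ Icc (0 : ℝ) 1, ∃ C, ∀ᶠ u in 𝓝[≠] τ, f u - N u = C := fun τ hτ => by
    refine exists_const_of_left_right ?_
    filter_upwards [hJ τ hτ, hleft τ] with u hu hu'
    filter_upwards [hu, hright τ] with v hv hv'
    rw [hu', hv', ← hv]
    abel
  choose! C hC using hg
  have hC01 := const_of_punctured_const zero_le_one hC
  have hlt : ∀ τ : ℝ, 𝓝[<] τ ≤ 𝓝[≠] τ := fun τ => nhdsWithin_mono _ fun u hu => ne_of_lt hu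
  refine ⟨C 0, ?_, ?_⟩
  · filter_upwards [(hC 0 (by simp)).filter_mono (hlt 0), hleft 0] with u hu hu'
    rw [← hu, hu', Finset.filter_false_of_mem fun σ hσ => not_lt.2 (hF σ hσ)]
    simp
  · filter_upwards [(hC 1 (by simp)).filter_mono (hlt 1), hleft 1] with u hu hu'
    rw [hC01, ← hu, hu']
    abel

/-- If `f` is piecewise constant and `f (t + 1) - f t` does not depend on `t`, it is the sum of the
jumps of `f` in a period. -/
theorem period_eq_sum_jumps {A : Type*} [AddCommGroup A] {f : ℝ → A} {L : A}
    (hper : ∀ t, f (t + 1) = f t + L) {F : Finset ℝ} {J : ℝ → A}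
    (hF : ∀ σ ∈ F, σ ∈ Ico (0 : ℝ) 1)
    (hJ : ∀ τ ∈ Ico (0 : ℝ) 1, ∀ᶠ u in 𝓝[<] τ, ∀ᶠ v in 𝓝[>] τ,
      f v - f u = if τ ∈ F then J τ else 0) :
    L = ∑ σ ∈ F, J σ := by
  classical
  -- the jump at `1` is the jump at `0`; it is not counted, being outside `[0, 1)`
  let J' : ℝ → A := fun τ => if τ = 1 then (if (0 : ℝ) ∈ F then J 0 else 0) else J τ
  have hleft : Tendsto (fun t : ℝ => t - 1) (𝓝[<] 1) (𝓝[<] 0) := by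
    refine tendsto_nhdsWithin_iff.2 ⟨?_, ?_⟩
    · have : Tendsto (fun t : ℝ => t - 1) (𝓝 1) (𝓝 (1 - 1)) :=
        (continuous_id.sub continuous_const).tendsto 1
      rw [sub_self] at this
      exact this.mono_left nhdsWithin_le_nhds
    · filter_upwards [self_mem_nhdsWithin] with u hu
      exact sub_neg.2 (mem_Iio.1 hu)
  have hright : Tendsto (fun t : ℝ => t - 1) (𝓝[>] 1) (𝓝[>] 0) := by
    refine tendsto_nhdsWithin_iff.2 ⟨?_, ?_⟩
    · have : Tendsto (fun t : ℝ => t - 1) (𝓝 1) (𝓝 (1 - 1)) :=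
        (continuous_id.sub continuous_const).tendsto 1
      rw [sub_self] at this
      exact this.mono_left nhdsWithin_le_nhds
    · filter_upwards [self_mem_nhdsWithin] with u hu
      exact sub_pos.2 (mem_Ioi.1 hu)
  have hshift : ∀ t, f t = f (t - 1) + L := fun t => by rw [← hper, sub_add_cancel]
  obtain ⟨C, h0, h1⟩ := increment_eq_sum_jumps (f := f) (F := insert 1 F) (J := J')
    (by
      intro σ hσ
      rcases Finset.mem_insert.1 hσ with rfl | hσ
      · exact zero_le_one
      · exact (hF σ hσ).1)
    (by
      intro τ hτ
      by_cases h : τ = 1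
      · subst h
        have := hJ 0 (by simp)
        filter_upwards [hleft.eventually this] with u hu
        filter_upwards [hright.eventually hu] with v hv
        rw [hshift u, hshift v, if_pos (Finset.mem_insert_self _ _), add_sub_add_right_eq_sub, hv]
        simp [J']
      · simpa [J', h] using hJ τ ⟨hτ.1, lt_of_le_of_ne hτ.2 h⟩)
  have hsum : ∑ σ ∈ insert 1 F with σ < 1, J' σ = ∑ σ ∈ F, J σ := by
    have : (insert 1 F).filter (· < 1) = F := by
      ext σ
      simp only [Finset.mem_filter, Finset.mem_insert]
      constructor
      · rintro ⟨rfl | h, h'⟩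
        · exact absurd h' (lt_irrefl _)
        · exact h
      · exact fun h => ⟨.inr h, (hF σ h).2⟩
    rw [this]
    exact Finset.sum_congr rfl fun σ hσ => if_neg (hF σ hσ).2.ne
  obtain ⟨u, hu, hu'⟩ := (h1.and (hleft.eventually h0)).exists
  rw [hshift, hu', hsum] at hu
  exact add_left_cancel hu

end Jumps

/-! ### Potentials on unions of disks -/

section Potentials

variable {X M : Type} [TopologicalSpace X] [TopologicalSpace M]

/-- On a disk the class of a path modulo boundaries is the difference of the values of a function
at its end points. -/
theorem exists_potential_of_disk {f : X → M} (hf : Continuous f) (K : Set X) (h : K ≃ₜ Disk) :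
    ∃ a : X → Chains1 M, ∀ (γ : ℝ → X) (u v : ℝ), u ≤ v → ContinuousOn γ (Icc u v) →
      MapsTo γ (Icc u v) K → seg (f ∘ γ) u v = a (γ v) - a (γ u) := by
  classical
  have hc0 : (0 : ℂ) ∈ Metric.closedBall (0 : ℂ) 1 := Metric.mem_closedBall_self zero_le_one
  -- `Ψ` is `f` read on the disk and `η` the inverse chart, both extended by arbitrary values; the
  -- potential at `x` is the class of the radius ending at `η x`
  let Ψ : ℂ → M := fun z =>
    if hz : z ∈ Metric.closedBall (0 : ℂ) 1 then f (h.symm ⟨z, hz⟩) else f (h.symm ⟨0, hc0⟩)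
  have hconv : Convex ℝ (Metric.closedBall (0 : ℂ) 1) := convex_closedBall _ _
  have hΨ : ContinuousOn Ψ (Metric.closedBall (0 : ℂ) 1) := by
    rw [continuousOn_iff_continuous_domRestrict]
    have : (Metric.closedBall (0 : ℂ) 1).domRestrict Ψ = fun z => f (h.symm z) := by
      funext z
      exact dif_pos z.2
    rw [this]
    exact hf.comp (continuous_subtype_val.comp h.symm.continuous)
  let η : X → ℂ := fun x => if hx : x ∈ K then (h ⟨x, hx⟩ : ℂ) else 0
  have hη : ContinuousOn η K := by
    rw [continuousOn_iff_continuous_domRestrict]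
    have : K.domRestrict η = fun z => (h z : ℂ) := by
      funext z
      exact dif_pos z.2
    rw [this]
    exact continuous_subtype_val.comp h.continuous
  have hηmem : ∀ x, η x ∈ Metric.closedBall (0 : ℂ) 1 := fun x => by
    by_cases hx : x ∈ K
    · simp only [η, dif_pos hx]; exact (h ⟨x, hx⟩).2
    · simp only [η, dif_neg hx]; exact hc0
  have hΨη : ∀ x ∈ K, Ψ (η x) = f x := fun x hx => by
    have : η x = h ⟨x, hx⟩ := dif_pos hx
    have h' : Ψ (η x) = f (h.symm ⟨η x, hηmem x⟩) := dif_pos _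
    have h2 : (⟨η x, hηmem x⟩ : Disk) = h ⟨x, hx⟩ := Subtype.ext this
    rw [h', h2, h.symm_apply_apply]
  refine ⟨fun x => seg Ψ 0 (η x), fun γ u v huv hγ hγK => ?_⟩
  have e1 : seg (f ∘ γ) u v = seg (Ψ ∘ (η ∘ γ)) u v := seg_congr fun a b ha hb hab => by
    have := (convex_Icc u v) (left_mem_Icc.2 huv) (right_mem_Icc.2 huv) ha hb hab
    exact (hΨη _ (hγK this)).symm
  rw [e1, seg_comp hconv hΨ huv (hη.comp hγ hγK) (fun t _ => hηmem _), eq_sub_iff_add_eq']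
  exact seg_add_seg hconv hΨ hc0 (hηmem _) (hηmem _)

/-- If `N` cuts every component of `R` into a disk, the potentials of these disks combine to a
potential on `R \ N`, since a path stays in one component. -/
theorem CutsIntoDisks.exists_potential {f : X → M} (hf : Continuous f) {R N : Set X}
    (hcut : CutsIntoDisks R N) :
    ∃ a : X → Chains1 M, ∀ (γ : ℝ → X) (u v : ℝ), u ≤ v → ContinuousOn γ (Icc u v) →
      MapsTo γ (Icc u v) (R \ N) → seg (f ∘ γ) u v = a (γ v) - a (γ u) := by
  have h : ∀ K : Set X, ∃ a : X → Chains1 M, Nonempty (K ≃ₜ Disk) → ∀ (γ : ℝ → X) (u v : ℝ),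
      u ≤ v → ContinuousOn γ (Icc u v) → MapsTo γ (Icc u v) K →
        seg (f ∘ γ) u v = a (γ v) - a (γ u) := fun K => by
    by_cases hK : Nonempty (K ≃ₜ Disk)
    · obtain ⟨a, ha⟩ := exists_potential_of_disk hf K hK.some
      exact ⟨a, fun _ => ha⟩
    · exact ⟨0, fun h => absurd h hK⟩
  choose a ha using h
  refine ⟨fun y => a (connectedComponentIn R y \ N) y, fun γ u v huv hγ hγR => ?_⟩
  have hu : u ∈ Icc u v := left_mem_Icc.2 huv
  have hsub : γ '' Icc u v ⊆ connectedComponentIn R (γ u) :=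
    (isPreconnected_Icc.image γ hγ).subset_connectedComponentIn (mem_image_of_mem γ hu)
      (image_subset_iff.2 fun t ht => (hγR ht).1)
  beta_reduce
  rw [← connectedComponentIn_eq (hsub (mem_image_of_mem γ (right_mem_Icc.2 huv)))]
  exact ha _ (hcut _ (hγR hu).1) γ u v huv hγ fun t ht =>
    ⟨hsub (mem_image_of_mem γ ht), (hγR ht).2⟩

end Potentials

/-! ### Tubes of a curve system -/

section Tubes

open Filter Topology

variable {S : Type} [TopologicalSpace S] [ChartedSpace (EuclideanHalfSpace 2) S]
  [IsManifold (𝓡∂ 2) ∞ S]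

namespace CurveSystem

variable {o : SurfaceOrientation S} {d l : ℕ} (C : CurveSystem o d l)

/-- The tubular neighbourhood of the `k`-th curve, circles and arcs alike. -/
def tube : Fin d ⊕ Fin l → ℝ → ℝ → S
  | .inl i => (C.circle i).tube
  | .inr i => (C.arc i).tube

variable (d l) in
/-- The domain on which the tube of the `k`-th curve is a parametrisation. -/
def tubeDom : Fin d ⊕ Fin l → Set (ℝ × ℝ)
  | .inl _ => univ ×ˢ Ioo (-2) 2
  | .inr _ => Icc 0 1 ×ˢ Ioo (-2) 2

theorem curve_eq_tube (k : Fin d ⊕ Fin l) (t : ℝ) : C.curve k t = C.tube k t 0 := by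
  cases k <;> rfl

theorem convex_tubeDom (k : Fin d ⊕ Fin l) : Convex ℝ (tubeDom d l k) := by
  cases k with
  | inl i => exact convex_univ.prod (convex_Ioo _ _)
  | inr i => exact (convex_Icc _ _).prod (convex_Ioo _ _)

theorem mk_mem_tubeDom {k : Fin d ⊕ Fin l} {z : ℝ × ℝ} (hz : z ∈ tubeDom d l k) {s : ℝ}
    (hs : s ∈ Ioo (-2 : ℝ) 2) : (z.1, s) ∈ tubeDom d l k := by
  cases k with
  | inl i => exact ⟨mem_univ _, hs⟩
  | inr i => exact ⟨hz.1, hs⟩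

theorem mk_mem_tubeDom_of_mem_Icc (k : Fin d ⊕ Fin l) {t s : ℝ} (ht : t ∈ Icc (0 : ℝ) 1)
    (hs : s ∈ Ioo (-2 : ℝ) 2) : (t, s) ∈ tubeDom d l k := by
  cases k with
  | inl i => exact ⟨mem_univ _, hs⟩
  | inr i => exact ⟨ht, hs⟩

theorem continuousOn_tube (k : Fin d ⊕ Fin l) :
    ContinuousOn (fun z : ℝ × ℝ => C.tube k z.1 z.2) (tubeDom d l k) := by
  cases k with
  | inl i => exact (C.circle i).smooth.continuousOn
  | inr i => exact (C.arc i).smooth.continuousOn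

/-- Every point of a tube has a coordinate along the core in `[0, 1]`. -/
theorem exists_mem_Icc (k : Fin d ⊕ Fin l) {z : ℝ × ℝ} (hz : z ∈ tubeDom d l k) :
    ∃ t ∈ Icc (0 : ℝ) 1, C.tube k t z.2 = C.tube k z.1 z.2 := by
  cases k with
  | inl i =>
    have hp : Function.Periodic (fun t => (C.circle i).tube t z.2) 1 :=
      fun t => (C.circle i).periodic t z.2
    refine ⟨Int.fract z.1, ⟨Int.fract_nonneg _, (Int.fract_lt_one _).le⟩, ?_⟩
    have := hp.sub_int_mul_eq ⌊z.1⌋ (x := z.1)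
    rwa [mul_one] at this
  | inr i => exact ⟨z.1, hz.1, rfl⟩

/-- The tubes are disjoint, and the coordinates of a point in a tube are unique, up to integral
translation in the case of a circle. -/
theorem tube_unique {k k' : Fin d ⊕ Fin l} {z z' : ℝ × ℝ} (hz : z ∈ tubeDom d l k)
    (hz' : z' ∈ tubeDom d l k') (h : C.tube k z.1 z.2 = C.tube k' z'.1 z'.2) :
    k = k' ∧ z.2 = z'.2 ∧ C.tube k z.1 = C.tube k' z'.1 := by
  have key : k = k' → z.2 = z'.2 ∧ C.tube k z.1 = C.tube k' z'.1 := by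
    rintro rfl
    cases k with
    | inl i =>
      obtain ⟨hs, m, hm⟩ := (C.circle i).injective _ _ _ _ hz.2 hz'.2 h
      refine ⟨hs, funext fun s => ?_⟩
      have hp : Function.Periodic (fun t => (C.circle i).tube t s) 1 :=
        fun t => (C.circle i).periodic t s
      have := hp.int_mul m z.1
      rw [mul_one] at this
      change (C.circle i).tube z.1 s = (C.circle i).tube z'.1 s
      rw [hm]
      exact this.symm
    | inr i =>
      obtain ⟨ht, hs⟩ := (C.arc i).injective _ hz.1 _ hz.2 _ hz'.1 _ hz'.2 h
      exact ⟨hs, by rw [ht]⟩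
  suffices hk : k = k' from ⟨hk, key hk⟩
  by_contra hne
  cases k with
  | inl i =>
    have hx : C.tube (.inl i) z.1 z.2 ∈ (C.circle i).nbhd 2 := ⟨z.1, z.2, hz.2, rfl⟩
    cases k' with
    | inl j =>
      exact disjoint_left.1 (C.disjoint_circles fun hij => hne (congrArg _ hij)) hx
        ⟨z'.1, z'.2, hz'.2, h.symm⟩
    | inr j =>
      exact disjoint_left.1 (C.disjoint_circle_arc i j) hx ⟨z'.1, hz'.1, z'.2, hz'.2, h.symm⟩
  | inr i =>
    have hx : C.tube (.inr i) z.1 z.2 ∈ (C.arc i).nbhd 2 := ⟨z.1, hz.1, z.2, hz.2, rfl⟩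
    cases k' with
    | inl j =>
      exact disjoint_left.1 (C.disjoint_circle_arc j i) ⟨z'.1, z'.2, hz'.2, h.symm⟩ hx
    | inr j =>
      exact disjoint_left.1 (C.disjoint_arcs fun hij => hne (congrArg _ hij)) hx
        ⟨z'.1, hz'.1, z'.2, hz'.2, h.symm⟩

theorem exists_of_mem_nhbd {x : S} (hx : x ∈ C.circleNbhd ∪ C.arcNbhd) :
    ∃ k, ∃ z ∈ tubeDom d l k, |z.2| < 1 ∧ C.tube k z.1 z.2 = x := by
  have hs2 : ∀ s : ℝ, s ∈ Ioo (-1 : ℝ) 1 → s ∈ Ioo (-2 : ℝ) 2 := fun s hs =>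
    ⟨by linarith [hs.1], by linarith [hs.2]⟩
  rcases hx with ⟨i, t, s, hs, h⟩ | ⟨i, t, ht, s, hs, h⟩
  · exact ⟨.inl i, (t, s), ⟨mem_univ _, hs2 s hs⟩, abs_lt.2 hs, h⟩
  · exact ⟨.inr i, (t, s), ⟨ht, hs2 s hs⟩, abs_lt.2 hs, h⟩

theorem notMem_nhbd {k : Fin d ⊕ Fin l} {z : ℝ × ℝ} (hz : z ∈ tubeDom d l k)
    (h1 : 1 ≤ |z.2|) : C.tube k z.1 z.2 ∉ C.circleNbhd ∪ C.arcNbhd := fun hx => by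
  obtain ⟨k', z', hz', h1', h⟩ := C.exists_of_mem_nhbd hx
  have := (C.tube_unique hz hz' h.symm).2.1
  rw [this] at h1
  exact absurd h1' (not_lt.2 h1)

theorem isClosed_tube [T2Space S] (k : Fin d ⊕ Fin l) :
    IsClosed {x | ∃ z ∈ tubeDom d l k, |z.2| ≤ 1 ∧ C.tube k z.1 z.2 = x} := by
  have hs2 : ∀ s : ℝ, |s| ≤ 1 → s ∈ Ioo (-2 : ℝ) 2 := fun s hs =>
    ⟨by linarith [(abs_le.1 hs).1], by linarith [(abs_le.1 hs).2]⟩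
  have : {x | ∃ z ∈ tubeDom d l k, |z.2| ≤ 1 ∧ C.tube k z.1 z.2 = x} =
      (fun z : ℝ × ℝ => C.tube k z.1 z.2) '' (Icc 0 1 ×ˢ Icc (-1) 1) := by
    ext x
    constructor
    · rintro ⟨z, hz, h1, rfl⟩
      obtain ⟨t, ht, h⟩ := C.exists_mem_Icc k hz
      exact ⟨(t, z.2), ⟨ht, abs_le.1 h1⟩, h⟩
    · rintro ⟨z, ⟨h0, h1⟩, rfl⟩
      exact ⟨z, mk_mem_tubeDom_of_mem_Icc k h0 (hs2 _ (abs_le.2 h1)), abs_le.2 h1, rfl⟩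
  rw [this]
  refine ((isCompact_Icc.prod isCompact_Icc).image_of_continuousOn
    ((C.continuousOn_tube k).mono ?_)).isClosed
  exact fun z hz => mk_mem_tubeDom_of_mem_Icc k hz.1 (hs2 _ (abs_le.2 hz.2))

/-- Near an interior point of `S` a tube is smooth and positively oriented. -/
theorem tube_interior {k : Fin d ⊕ Fin l} {z : ℝ × ℝ} (hz : z ∈ tubeDom d l k)
    (hint : (𝓡∂ 2).IsInteriorPoint (C.tube k z.1 z.2)) :
    tubeDom d l k ∈ 𝓝 z ∧
      ContMDiffAt 𝓘(ℝ, ℝ × ℝ) (𝓡∂ 2) ∞ (fun p : ℝ × ℝ => C.tube k p.1 p.2) z ∧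
      0 < o.area (C.tube k z.1 z.2) (velocity (fun t => C.tube k t z.2) z.1)
        (velocity (fun s => C.tube k z.1 s) z.2) := by
  cases k with
  | inl i =>
    have hn : tubeDom d l (.inl i) ∈ 𝓝 z := (isOpen_univ.prod isOpen_Ioo).mem_nhds hz
    exact ⟨hn, (C.circle i).smooth.contMDiffAt hn, (C.circle i).positive z.1 z.2 hz.2⟩
  | inr i =>
    have hne := (not_congr ((C.arc i).boundary z.1 hz.1 z.2 hz.2)).1
      (by rw [← (𝓡∂ 2).isInteriorPoint_iff_not_isBoundaryPoint]; exact hint)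
    push Not at hne
    have hz1 : z.1 ∈ Ioo (0 : ℝ) 1 :=
      ⟨lt_of_le_of_ne hz.1.1 hne.1.symm, lt_of_le_of_ne hz.1.2 hne.2⟩
    have hn : tubeDom d l (.inr i) ∈ 𝓝 z :=
      mem_of_superset ((isOpen_Ioo.prod isOpen_Ioo).mem_nhds ⟨hz1, hz.2⟩)
        (prod_mono Ioo_subset_Icc_self subset_rfl)
    refine ⟨hn, (C.arc i).smooth.contMDiffAt hn, ?_⟩
    have := (C.arc i).positive z.1 hz.1 z.2 hz.2
    rwa [velocityWithin, mfderivWithin_of_mem_nhds (Icc_mem_nhds hz1.1 hz1.2)] at this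

end CurveSystem

end Tubes

/-! ### The class of a loop in terms of its crossings -/

section Crossings

open Filter Topology

variable {S : Type} [TopologicalSpace S] [ChartedSpace (EuclideanHalfSpace 2) S]
  [IsManifold (𝓡∂ 2) ∞ S]

namespace CurveSystem

variable {o : SurfaceOrientation S} {d l : ℕ} (C : CurveSystem o d l)
variable {M : Type} [TopologicalSpace M]

/-- `a` is a potential outside the tubes of radius one for the map `J`: the class of the image of
a path outside these tubes is the difference of the values of `a` at its end points. -/
def IsOuterPotential (J : S → M) (a : S → Chains1 M) : Prop :=
  ∀ (γ : ℝ → S) (u v : ℝ), u ≤ v → ContinuousOn γ (Icc u v) →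
    MapsTo γ (Icc u v) (C.circleNbhd ∪ C.arcNbhd)ᶜ → seg (J ∘ γ) u v = a (γ v) - a (γ u)

/-- The boundary component `s = 1` or `s = -1` of the tube of radius one to which a point with
normal coordinate `s` is pushed; points on the core go to `s = -1`. -/
def side (s : ℝ) : ℝ := if 0 < s then 1 else -1

theorem abs_side (s : ℝ) : |side s| = 1 := by
  unfold side; split_ifs <;> simp

theorem side_mem (s : ℝ) : side s ∈ Ioo (-2 : ℝ) 2 := by
  unfold side; split_ifs <;> norm_num

/-- The tube of the `k`-th curve, mapped to `M`. -/
def tubeMap (J : S → M) (k : Fin d ⊕ Fin l) (z : ℝ × ℝ) : M := J (C.tube k z.1 z.2)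

open Classical in
/-- The extension of an outer potential `a` to `S`, by pushing points of the tubes out along the
normal segments. -/
def potential (J : S → M) (a : S → Chains1 M) (x : S) : Chains1 M :=
  if h : ∃ p : (Fin d ⊕ Fin l) × (ℝ × ℝ), p.2 ∈ tubeDom d l p.1 ∧ C.tube p.1 p.2.1 p.2.2 = x then
    a (C.tube h.choose.1 h.choose.2.1 (side h.choose.2.2)) +
      seg (J ∘ C.tube h.choose.1 h.choose.2.1) (side h.choose.2.2) h.choose.2.2
  else a x

/-- The discrepancy between the extended potential and the potential of the tube of the `k`-th
curve on the side `s` of the core. -/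
def sideClass (J : S → M) (a : S → Chains1 M) (k : Fin d ⊕ Fin l) (s : ℝ) : Chains1 M :=
  a (C.tube k 2⁻¹ s) - seg (C.tubeMap J k) (2⁻¹, 1) (2⁻¹, s)

/-- The class `E_k` attached to the `k`-th curve: a normal segment, closed up by the outer
potential. -/
def crossingClass (J : S → M) (a : S → Chains1 M) (k : Fin d ⊕ Fin l) : Chains1 M :=
  C.sideClass J a k 1 - C.sideClass J a k (-1)

variable {C} {J : S → M} {a : S → Chains1 M}

/-- The extended potential does not depend on the coordinates chosen for a point of a tube. -/
theorem potential_tube {k : Fin d ⊕ Fin l} {z : ℝ × ℝ} (hz : z ∈ tubeDom d l k) :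
    C.potential J a (C.tube k z.1 z.2) =
      a (C.tube k z.1 (side z.2)) + seg (C.tubeMap J k) (z.1, side z.2) z := by
  have h : ∃ p : (Fin d ⊕ Fin l) × (ℝ × ℝ), p.2 ∈ tubeDom d l p.1 ∧
    C.tube p.1 p.2.1 p.2.2 = C.tube k z.1 z.2 := ⟨(k, z), hz, rfl⟩
  rw [potential, dif_pos h]
  obtain ⟨-, h2, h3⟩ := C.tube_unique h.choose_spec.1 hz h.choose_spec.2
  rw [h2, h3]
  congr 1
  refine seg_congr fun x y _ _ hxy => ?_
  have : x * z.1 + y * z.1 = z.1 := by rw [← add_mul, hxy, one_mul]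
  simp [tubeMap, this]

theorem continuousOn_tubeMap (hJ : Continuous J) (k : Fin d ⊕ Fin l) :
    ContinuousOn (C.tubeMap J k) (tubeDom d l k) :=
  hJ.comp_continuousOn (C.continuousOn_tube k)

/-- The outer potential computes the class of a straight segment in a tube that avoids the open
tube of radius one. -/
theorem IsOuterPotential.seg_tubeMap (ha : C.IsOuterPotential J a) {k : Fin d ⊕ Fin l}
    {z z' : ℝ × ℝ} (hz : z ∈ tubeDom d l k) (hz' : z' ∈ tubeDom d l k)
    (h : ∀ x ∈ Icc (0 : ℝ) 1, 1 ≤ |(1 - x) * z.2 + x * z'.2|) :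
    seg (C.tubeMap J k) z z' = a (C.tube k z'.1 z'.2) - a (C.tube k z.1 z.2) := by
  let ℓ : ℝ → ℝ × ℝ := fun x => (1 - x) • z + x • z'
  have hℓ : MapsTo ℓ (Icc 0 1) (tubeDom d l k) := fun x hx =>
    convex_tubeDom k hz hz' (sub_nonneg.2 hx.2) hx.1 (by ring)
  have := ha (fun x => C.tube k (ℓ x).1 (ℓ x).2) 0 1 zero_le_one
    ((C.continuousOn_tube k).comp (by fun_prop) hℓ) fun x hx => C.notMem_nhbd (hℓ hx) (h x hx)
  have e : seg (C.tubeMap J k) z z' =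
      seg (J ∘ fun x => C.tube k (ℓ x).1 (ℓ x).2) (0 : ℝ) 1 := by
    refine seg_congr fun x y _ _ hxy => ?_
    obtain rfl : x = 1 - y := by linarith
    simp [tubeMap, ℓ]
  rw [e, this]
  simp [ℓ]

theorem potential_of_notMem (ha : C.IsOuterPotential J a) {x : S}
    (hx : x ∉ C.circleNbhd ∪ C.arcNbhd) (hx' : ∀ k, ∀ z ∈ tubeDom d l k, C.tube k z.1 z.2 = x →
      1 ≤ |z.2|) :
    C.potential J a x = a x := by
  by_cases h : ∃ p : (Fin d ⊕ Fin l) × (ℝ × ℝ), p.2 ∈ tubeDom d l p.1 ∧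
    C.tube p.1 p.2.1 p.2.2 = x
  · obtain ⟨⟨k, z⟩, hz, rfl⟩ := h
    have h1 := hx' k z hz rfl
    rw [potential_tube hz, ha.seg_tubeMap (mk_mem_tubeDom hz (side_mem _)) hz, add_sub_cancel]
    intro x hx
    simp only [side]
    split_ifs with hs
    · rw [abs_of_pos hs] at h1
      exact le_trans (by nlinarith [hx.1]) (le_abs_self _)
    · rw [abs_of_nonpos (not_lt.1 hs)] at h1
      exact le_trans (by nlinarith [hx.1]) (neg_le_abs _)
  · rw [potential, dif_neg h]

/-- The class of a segment in a tube, up to the difference of the potentials at its end points,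
depends only on the sides of the core on which these end points lie. -/
theorem seg_tubeMap_sub_potential (hJ : Continuous J) (ha : C.IsOuterPotential J a)
    {k : Fin d ⊕ Fin l} {z z' : ℝ × ℝ} (hz : z ∈ tubeDom d l k) (hz' : z' ∈ tubeDom d l k) :
    seg (C.tubeMap J k) z z' -
        (C.potential J a (C.tube k z'.1 z'.2) - C.potential J a (C.tube k z.1 z.2)) =
      C.sideClass J a k (side z.2) - C.sideClass J a k (side z'.2) := by
  have hF := continuousOn_tubeMap (C := C) hJ k
  have hK := convex_tubeDom (d := d) (l := l) k
  have hhalf : ∀ s ∈ Ioo (-2 : ℝ) 2, ((2⁻¹, s) : ℝ × ℝ) ∈ tubeDom d l k := fun s hs =>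
    mk_mem_tubeDom_of_mem_Icc k (by constructor <;> norm_num) hs
  have h0 := hhalf 1 (by constructor <;> norm_num)
  -- on each side of the core, the potential and the class of the segment from `(1/2, 1)` differ by a
  -- constant
  have key : ∀ z ∈ tubeDom d l k, C.potential J a (C.tube k z.1 z.2) -
      seg (C.tubeMap J k) (2⁻¹, 1) z = C.sideClass J a k (side z.2) := fun z hz => by
    have hzs := mk_mem_tubeDom hz (side_mem z.2)
    have hs := hhalf _ (side_mem z.2)
    have e1 := seg_add_seg hK hF h0 hzs hz
    have e2 := seg_add_seg hK hF h0 hs hzs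
    have e3 := ha.seg_tubeMap hs hzs fun x _ => by
      rw [← add_mul, sub_add_cancel, one_mul, abs_side]
    rw [potential_tube hz, sideClass, ← e1, ← e2, e3]
    abel
  rw [← key z hz, ← key z' hz', ← seg_add_seg hK hF h0 hz hz']
  abel

variable (C J a) in
/-- The class of the loop `c` up to time `t`, corrected by the potential at `c t`; it changes only
at the crossings of `c`. -/
def discrepancy (c : ℝ → S) (t : ℝ) : Chains1 M := seg (J ∘ c) 0 t - C.potential J a (c t)

theorem discrepancy_sub (hJ : Continuous J) {c : ℝ → S} (hc : Continuous c) (u v : ℝ) :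
    C.discrepancy J a c v - C.discrepancy J a c u =
      seg (J ∘ c) u v - (C.potential J a (c v) - C.potential J a (c u)) := by
  rw [discrepancy, discrepancy, ← seg_add_seg (F := J ∘ c) convex_univ
    (hJ.comp hc).continuousOn (mem_univ 0) (mem_univ u) (mem_univ v)]
  abel

/-- The discrepancy is constant while the loop is outside the closed tubes of radius one. -/
theorem discrepancy_of_notMem [T2Space S] (hJ : Continuous J) (ha : C.IsOuterPotential J a)
    {c : ℝ → S} (hc : Continuous c) {τ : ℝ}
    (hτ : ∀ k, ∀ z ∈ tubeDom d l k, |z.2| ≤ 1 → C.tube k z.1 z.2 ≠ c τ) :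
    ∃ V ∈ 𝓝 τ, ∀ u ∈ V, ∀ v ∈ V, u ≤ v →
      C.discrepancy J a c v - C.discrepancy J a c u = 0 := by
  have hev : ∀ᶠ u in 𝓝 τ, ∀ k, ¬ ∃ z ∈ tubeDom d l k, |z.2| ≤ 1 ∧ C.tube k z.1 z.2 = c u := by
    rw [eventually_all]
    intro k
    refine hc.continuousAt.eventually ((C.isClosed_tube k).isOpen_compl.mem_nhds ?_)
    rintro ⟨z, hz, h1, h2⟩
    exact hτ k z hz h1 h2
  obtain ⟨ε, hε, hV⟩ := Metric.eventually_nhds_iff_ball.1 hev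
  rw [Real.ball_eq_Ioo] at hV
  refine ⟨_, Ioo_mem_nhds (sub_lt_self τ hε) (lt_add_of_pos_right τ hε), fun u hu v hv huv => ?_⟩
  have hout : ∀ t ∈ Ioo (τ - ε) (τ + ε), c t ∉ C.circleNbhd ∪ C.arcNbhd := fun t ht h => by
    obtain ⟨k, z, hz, h1, h2⟩ := C.exists_of_mem_nhbd h
    exact hV t ht k ⟨z, hz, h1.le, h2⟩
  have hpot : ∀ t ∈ Ioo (τ - ε) (τ + ε), C.potential J a (c t) = a (c t) := fun t ht =>
    potential_of_notMem ha (hout t ht) fun k z hz h => by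
      by_contra h1
      exact hV t ht k ⟨z, hz, (not_le.1 h1).le, h⟩
  rw [discrepancy_sub hJ hc, hpot u hu, hpot v hv,
    ha c u v huv hc.continuousOn fun t ht => hout t ⟨hu.1.trans_le ht.1, ht.2.trans_lt hv.2⟩,
    sub_self]

/-- While the loop is in a tube, the discrepancy depends only on the side of the core on which the
loop lies. In the local coordinates of the tube, the normal coordinate `s` of the loop has a
derivative `w` of sign opposite to that of the crossing. -/
theorem discrepancy_of_mem (hJ : Continuous J) (ha : C.IsOuterPotential J a)
    {c : ℝ → S} (hc : Continuous c) {τ : ℝ} {k : Fin d ⊕ Fin l} {z : ℝ × ℝ}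
    (hz : z ∈ tubeDom d l k) (hcτ : c τ = C.tube k z.1 z.2)
    (hint : (𝓡∂ 2).IsInteriorPoint (c τ)) (hdiff : MDifferentiableAt 𝓘(ℝ, ℝ) (𝓡∂ 2) c τ) :
    ∃ s : ℝ → ℝ, s τ = z.2 ∧ ContinuousAt s τ ∧
      (∃ V ∈ 𝓝 τ, ∀ u ∈ V, ∀ v ∈ V, u ≤ v →
        C.discrepancy J a c v - C.discrepancy J a c u =
          C.sideClass J a k (side (s u)) - C.sideClass J a k (side (s v))) ∧
      ∃ w, HasDerivAt s w τ ∧ SignType.sign (o.area (c τ) (velocity c τ)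
        (velocity (fun t => C.tube k t z.2) z.1)) = -SignType.sign w := by
  rw [hcτ] at hint
  obtain ⟨hn, hs, hpos⟩ := C.tube_interior hz hint
  obtain ⟨g, hgz, hg, hgc⟩ := exists_local_coordinates o hs hpos
  obtain ⟨w, hw, hw'⟩ := hgc c τ hcτ hdiff
  rw [← hcτ] at hg hgz
  have hgτ : ContinuousAt (fun u => g (c u)) τ := hg.self_of_nhds.2.comp hc.continuousAt
  refine ⟨fun u => (g (c u)).2, by beta_reduce; rw [hgz],
    continuous_snd.continuousAt.comp hgτ, ?_, w, hw, ?_⟩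
  · have hev : ∀ᶠ u in 𝓝 τ, (C.tube k (g (c u)).1 (g (c u)).2 = c u ∧ ContinuousAt g (c u)) ∧
        g (c u) ∈ tubeDom d l k :=
      (hc.continuousAt.eventually hg).and (hgτ.eventually (by beta_reduce; rw [hgz]; exact hn))
    obtain ⟨ε, hε, hV⟩ := Metric.eventually_nhds_iff_ball.1 hev
    rw [Real.ball_eq_Ioo] at hV
    refine ⟨_, Ioo_mem_nhds (sub_lt_self τ hε) (lt_add_of_pos_right τ hε),
      fun u hu v hv huv => ?_⟩
    have hsub : Icc u v ⊆ Ioo (τ - ε) (τ + ε) := fun t ht =>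
      ⟨hu.1.trans_le ht.1, ht.2.trans_lt hv.2⟩
    have e : seg (J ∘ c) u v = seg (C.tubeMap J k ∘ fun t => g (c t)) u v :=
      seg_congr fun x y hx hy hxy => by
        have := (convex_Icc u v) (left_mem_Icc.2 huv) (right_mem_Icc.2 huv) hx hy hxy
        exact congrArg J (hV _ (hsub this)).1.1.symm
    have e2 := seg_comp (convex_tubeDom k) (continuousOn_tubeMap (C := C) hJ k) huv
      (γ := fun t => g (c t)) (fun t ht => ((hV t (hsub ht)).1.2.comp
        hc.continuousAt).continuousWithinAt) fun t ht => (hV t (hsub ht)).2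
    rw [discrepancy_sub hJ hc, e, e2, ← seg_tubeMap_sub_potential hJ ha (hV u hu).2 (hV v hv).2,
      (hV u hu).1.1, (hV v hv).1.1]
  · rw [hw', sign_mul, sign_pos hpos, mul_one, Left.sign_neg]

/-- The discrepancy does not jump at a time when the loop is not on a curve. -/
theorem discrepancy_off_crossing [T2Space S] (hJ : Continuous J) (ha : C.IsOuterPotential J a)
    {c : ℝ → S} (hc : Continuous c) {τ : ℝ}
    (hint : (𝓡∂ 2).IsInteriorPoint (c τ)) (hdiff : MDifferentiableAt 𝓘(ℝ, ℝ) (𝓡∂ 2) c τ)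
    (hτ : ∀ k, ∀ t, (t, 0) ∈ tubeDom d l k → C.curve k t ≠ c τ) :
    ∀ᶠ u in 𝓝[<] τ, ∀ᶠ v in 𝓝[>] τ, C.discrepancy J a c v - C.discrepancy J a c u = 0 := by
  suffices h : ∃ V ∈ 𝓝 τ, ∀ u ∈ V, ∀ v ∈ V, u ≤ v →
      C.discrepancy J a c v - C.discrepancy J a c u = 0 by
    obtain ⟨V, hV, h⟩ := h
    filter_upwards [mem_nhdsWithin_of_mem_nhds hV, self_mem_nhdsWithin] with u hu hu'
    filter_upwards [mem_nhdsWithin_of_mem_nhds hV, self_mem_nhdsWithin] with v hv hv'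
    exact h u hu v hv (le_of_lt (lt_trans hu' hv'))
  by_cases hmem : ∀ k, ∀ z ∈ tubeDom d l k, |z.2| ≤ 1 → C.tube k z.1 z.2 ≠ c τ
  · exact discrepancy_of_notMem hJ ha hc hmem
  · push Not at hmem
    obtain ⟨k, z, hz, -, hzc⟩ := hmem
    have hz2 : z.2 ≠ 0 := fun h0 => hτ k z.1 (by rw [← h0]; exact hz)
      (by rw [curve_eq_tube, ← h0]; exact hzc)
    obtain ⟨s, hs, hsc, ⟨V, hV, h⟩, -⟩ := discrepancy_of_mem hJ ha hc hz hzc.symm hint hdiff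
    have hside : ∀ᶠ u in 𝓝 τ, side (s u) = side z.2 := by
      rw [← hs] at hz2 ⊢
      rcases lt_or_gt_of_ne hz2 with h0 | h0
      · filter_upwards [hsc.eventually (gt_mem_nhds h0)] with u hu
        rw [side, side, if_neg hu.not_gt, if_neg h0.not_gt]
      · filter_upwards [hsc.eventually (lt_mem_nhds h0)] with u hu
        rw [side, side, if_pos hu, if_pos h0]
    refine ⟨V ∩ {u | side (s u) = side z.2}, inter_mem hV hside, fun u hu v hv huv => ?_⟩
    rw [h u hu.1 v hv.1 huv, hu.2, hv.2, sub_self]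

/-- At a crossing with the `k`-th curve the discrepancy jumps by the signed class `E_k`. -/
theorem discrepancy_at_crossing (hJ : Continuous J) (ha : C.IsOuterPotential J a)
    {c : ℝ → S} (hc : Continuous c) {τ t : ℝ} {k : Fin d ⊕ Fin l}
    (ht : (t, 0) ∈ tubeDom d l k) (hcτ : c τ = C.curve k t)
    (hint : (𝓡∂ 2).IsInteriorPoint (c τ)) (hdiff : MDifferentiableAt 𝓘(ℝ, ℝ) (𝓡∂ 2) c τ)
    (hne : o.area (c τ) (velocity c τ) (velocity (C.curve k) t) ≠ 0) :
    ∀ᶠ u in 𝓝[<] τ, ∀ᶠ v in 𝓝[>] τ, C.discrepancy J a c v - C.discrepancy J a c u =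
      (SignType.sign (o.area (c τ) (velocity c τ) (velocity (C.curve k) t)) : ℤ) •
        C.crossingClass J a k := by
  rw [curve_eq_tube] at hcτ
  have hcurve : C.curve k = fun t => C.tube k t 0 := funext (C.curve_eq_tube k)
  obtain ⟨s, hs, hsc, ⟨V, hV, h⟩, w, hw, hsign⟩ := discrepancy_of_mem hJ ha hc ht hcτ hint hdiff
  rw [← hcurve] at hsign
  have hside : ∀ σ : ℝ, 0 < σ → side σ = 1 := fun σ h0 => if_pos h0
  have hside' : ∀ σ : ℝ, σ < 0 → side σ = -1 := fun σ h0 => if_neg h0.not_gt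
  have hw0 : w ≠ 0 := by
    rintro rfl
    rw [sign_zero, neg_zero, sign_eq_zero_iff] at hsign
    exact hne hsign
  rw [hsign]
  rcases lt_or_gt_of_ne hw0 with h0 | h0
  · have hev := eventually_nhdsWithin_sign_eq_of_deriv_neg (by rw [hw.deriv]; exact h0) hs
    filter_upwards [mem_nhdsWithin_of_mem_nhds hV, self_mem_nhdsWithin,
      nhdsWithin_le_nhds hev] with u hu hu' hus
    filter_upwards [mem_nhdsWithin_of_mem_nhds hV, self_mem_nhdsWithin,
      nhdsWithin_le_nhds hev] with v hv hv' hvs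
    rw [sign_pos (sub_pos.2 (mem_Iio.1 hu')), sign_eq_one_iff] at hus
    rw [sign_neg (sub_neg.2 (mem_Ioi.1 hv')), sign_eq_neg_one_iff] at hvs
    rw [h u hu v hv (le_of_lt (lt_trans hu' hv')), hside _ hus, hside' _ hvs, sign_neg h0]
    simp [crossingClass]
  · have hev := eventually_nhdsWithin_sign_eq_of_deriv_pos (by rw [hw.deriv]; exact h0) hs
    filter_upwards [mem_nhdsWithin_of_mem_nhds hV, self_mem_nhdsWithin,
      nhdsWithin_le_nhds hev] with u hu hu' hus
    filter_upwards [mem_nhdsWithin_of_mem_nhds hV, self_mem_nhdsWithin,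
      nhdsWithin_le_nhds hev] with v hv hv' hvs
    rw [sign_neg (sub_neg.2 (mem_Iio.1 hu')), sign_eq_neg_one_iff] at hus
    rw [sign_pos (sub_pos.2 (mem_Ioi.1 hv')), sign_eq_one_iff] at hvs
    rw [h u hu v hv (le_of_lt (lt_trans hu' hv')), hside' _ hus, hside _ hvs, sign_pos h0]
    simp [crossingClass]

/-- After a period the discrepancy has increased by the class of the loop. -/
theorem discrepancy_add_one (hJ : Continuous J) {c : ℝ → S} (hc : Continuous c)
    (hper : ∀ t, c (t + 1) = c t) (t : ℝ) :
    C.discrepancy J a c (t + 1) = C.discrepancy J a c t + seg (J ∘ c) 0 1 := by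
  have e : seg (J ∘ c) 1 (t + 1) = seg (J ∘ c) 0 t := seg_congr fun x y _ _ hxy => by
    have : x • (1 : ℝ) + y • (t + 1) = (x • 0 + y • t) + 1 := by
      simp only [smul_eq_mul]; linear_combination hxy
    rw [Function.comp, this, hper]
    rfl
  rw [discrepancy, discrepancy, hper, ← e, ← seg_add_seg (F := J ∘ c) convex_univ
    (hJ.comp hc).continuousOn (mem_univ 0) (mem_univ 1) (mem_univ (t + 1))]
  abel

variable (C) in
/-- Every interior point of a curve has a parameter in `[0, 1)`: the end point of an arc lies on the
boundary of the surface. -/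
theorem exists_mem_Ico {k : Fin d ⊕ Fin l} {t : ℝ} (ht : (t, 0) ∈ tubeDom d l k)
    (hint : (𝓡∂ 2).IsInteriorPoint (C.curve k t)) :
    ∃ u ∈ Ico (0 : ℝ) 1, C.curve k u = C.curve k t := by
  cases k with
  | inl i =>
    have hp : Function.Periodic (fun t => (C.circle i).tube t 0) 1 :=
      fun t => (C.circle i).periodic t 0
    refine ⟨Int.fract t, ⟨Int.fract_nonneg _, Int.fract_lt_one _⟩, ?_⟩
    have := hp.sub_int_mul_eq ⌊t⌋ (x := t)
    rwa [mul_one] at this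
  | inr i =>
    have hne := (not_congr ((C.arc i).boundary t ht.1 0 ht.2)).1
      (by rw [← (𝓡∂ 2).isInteriorPoint_iff_not_isBoundaryPoint]; exact hint)
    push Not at hne
    exact ⟨t, ⟨ht.1.1, lt_of_le_of_ne ht.1.2 hne.2⟩, rfl⟩

variable (C) in
theorem curve_injective {k k' : Fin d ⊕ Fin l} {u u' : ℝ} (hu : u ∈ Ico (0 : ℝ) 1)
    (hu' : u' ∈ Ico (0 : ℝ) 1) (h : C.curve k u = C.curve k' u') : k = k' ∧ u = u' := by
  have h0 : (0 : ℝ) ∈ Ioo (-2 : ℝ) 2 := by constructor <;> norm_num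
  rw [curve_eq_tube, curve_eq_tube] at h
  obtain ⟨rfl, -, -⟩ := C.tube_unique
    (mk_mem_tubeDom_of_mem_Icc k (Ico_subset_Icc_self hu) h0)
    (mk_mem_tubeDom_of_mem_Icc k' (Ico_subset_Icc_self hu') h0) h
  refine ⟨rfl, ?_⟩
  cases k with
  | inl i =>
    obtain ⟨-, m, hm⟩ := (C.circle i).injective _ _ _ _ h0 h0 h
    have h1 : (m : ℝ) < 1 := by linarith [hu.1, hu'.2]
    have h2 : (-1 : ℝ) < m := by linarith [hu.2, hu'.1]
    have : m = 0 := by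
      have h1' : m < 1 := by exact_mod_cast h1
      have h2' : -1 < m := by exact_mod_cast h2
      omega
    rw [hm, this]; simp
  | inr i =>
    exact ((C.arc i).injective _ (Ico_subset_Icc_self hu) _ h0 _ (Ico_subset_Icc_self hu') _ h0
      h).1

/-- The class of a loop in `S` transverse to the curves is determined by its signed crossings. -/
theorem seg_loop_eq_sum [T2Space S] (hJ : Continuous J) (ha : C.IsOuterPotential J a)
    {c : ℝ → S} (hc : Continuous c) (hdiff : ∀ τ, MDifferentiableAt 𝓘(ℝ, ℝ) (𝓡∂ 2) c τ)
    (hper : ∀ t, c (t + 1) = c t) (hint : ∀ t, (𝓡∂ 2).IsInteriorPoint (c t))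
    {ι : Type*} {X : Finset ι} {τ u : ι → ℝ} {κ : ι → Fin d ⊕ Fin l}
    (hX : ∀ x ∈ X, τ x ∈ Ico (0 : ℝ) 1 ∧ u x ∈ Ico (0 : ℝ) 1 ∧ c (τ x) = C.curve (κ x) (u x))
    (hsurj : ∀ t ∈ Ico (0 : ℝ) 1, ∀ k, ∀ v ∈ Ico (0 : ℝ) 1, c t = C.curve k v →
      ∃ x ∈ X, τ x = t)
    (hinj : ∀ x ∈ X, ∀ y ∈ X, τ x = τ y → κ x = κ y → u x = u y → x = y)
    (hne : ∀ x ∈ X, o.area (c (τ x)) (velocity c (τ x)) (velocity (C.curve (κ x)) (u x)) ≠ 0) :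
    seg (J ∘ c) 0 1 = ∑ x ∈ X, (SignType.sign (o.area (c (τ x)) (velocity c (τ x))
      (velocity (C.curve (κ x)) (u x))) : ℤ) • C.crossingClass J a (κ x) := by
  classical
  have h0 : (0 : ℝ) ∈ Ioo (-2 : ℝ) 2 := by constructor <;> norm_num
  rw [← Finset.sum_fiberwise_of_maps_to (t := X.image τ) (g := τ)
    fun x hx => Finset.mem_image_of_mem _ hx]
  refine period_eq_sum_jumps (f := C.discrepancy J a c) (discrepancy_add_one hJ hc hper) ?_ ?_
  · intro σ hσ
    obtain ⟨x, hx, rfl⟩ := Finset.mem_image.1 hσ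
    exact (hX x hx).1
  · intro t ht
    split_ifs with hmem
    · obtain ⟨x, hx, rfl⟩ := Finset.mem_image.1 hmem
      have hx' := hX x hx
      have : X.filter (fun y => τ y = τ x) = {x} := by
        ext y
        rw [Finset.mem_filter, Finset.mem_singleton]
        refine ⟨fun ⟨hy, hyx⟩ => ?_, fun h => by rw [h]; exact ⟨hx, rfl⟩⟩
        have hy' := hX y hy
        have h := C.curve_injective hy'.2.1 hx'.2.1 (by rw [← hy'.2.2, ← hx'.2.2, hyx])
        exact hinj y hy x hx hyx h.1 h.2
      rw [this, Finset.sum_singleton]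
      exact discrepancy_at_crossing hJ ha hc
        (mk_mem_tubeDom_of_mem_Icc _ (Ico_subset_Icc_self hx'.2.1) h0) hx'.2.2 (hint _) (hdiff _)
        (hne x hx)
    · refine discrepancy_off_crossing hJ ha hc (hint _) (hdiff _) fun k v hv h => hmem ?_
      obtain ⟨w, hw, hw'⟩ := C.exists_mem_Ico hv (h ▸ hint t)
      obtain ⟨x, hx, hxt⟩ := hsurj t ht k w hw (hw'.trans h).symm
      exact Finset.mem_image.2 ⟨x, hx, hxt⟩

end CurveSystem

end Crossings

/-! ### The homological relation carried by a closed `α`-curve -/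

section Relation

open Filter Topology

variable {S : Type} [TopologicalSpace S] [ChartedSpace (EuclideanHalfSpace 2) S]
  [IsManifold (𝓡∂ 2) ∞ S]
variable {o : SurfaceOrientation S} {d la lb : ℕ}

theorem Manifold.continuous_mk (A : CurveSystem o d la) (B : CurveSystem o d lb) :
    Continuous (Manifold.mk A B) := continuous_quot_mk

theorem Disk.bdry_eq_iff {t t' : ℝ} (h : Disk.bdry t = Disk.bdry t') : ∃ m : ℤ, t = t' + m := by
  have h1 := congrArg Subtype.val h
  obtain ⟨m, hm⟩ := Complex.exp_eq_exp_iff_exists_int.1 h1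
  refine ⟨m, ?_⟩
  have h2 : (2 * Real.pi * Complex.I : ℂ) ≠ 0 := Complex.two_pi_I_ne_zero
  have h3 : ((t : ℂ) - (t' + m)) * (2 * Real.pi * Complex.I) = 0 := by
    linear_combination hm
  have h4 := (mul_eq_zero.1 h3).resolve_right h2
  rw [sub_eq_zero] at h4
  exact_mod_cast h4

/-- The glueing identifies no two points of `S × {1}`. -/
theorem Manifold.mk_upper_injective (A : CurveSystem o d la) (B : CurveSystem o d lb) :
    Function.Injective fun x : S => Manifold.mk A B (.inl (x, ⟨1, by simp⟩)) := by
  intro x y hxy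
  -- a predicate that separates `(y, 1)` from the other points of `S × {1}`
  let P : Pieces S d → Prop := fun p => match p with
    | .inl q => (q.2 : ℝ) = 1 ∧ q.1 = y
    | .inr (.inl _) => False
    | .inr (.inr q) => ∃ t, Disk.bdry t = q.2.1 ∧ (B.circle q.1).tube t q.2.2 = y
  have hP : ∀ p q, Glue A B p q → P p = P q := by
    rintro _ _ (⟨i, t, s⟩ | ⟨i, t, s⟩)
    · simp only [P, eq_iff_iff, false_iff]
      rintro ⟨h, -⟩
      norm_num at h
    · simp only [P, eq_iff_iff, true_and]
      refine ⟨?_, fun h => ⟨t, rfl, h⟩⟩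
      rintro ⟨t', ht', h⟩
      obtain ⟨m, rfl⟩ := Disk.bdry_eq_iff ht'
      have hp : Function.Periodic (fun t => (B.circle i).tube t s) 1 :=
        fun t => (B.circle i).periodic t s
      have := hp.int_mul m t
      rw [mul_one] at this
      exact this.symm.trans h
  have h : P (.inl (x, ⟨1, by simp⟩)) = P (.inl (y, ⟨1, by simp⟩)) :=
    congrArg (Quot.lift P hP) hxy
  exact (h.mpr ⟨rfl, rfl⟩).2

namespace HeegaardDiagram

variable (D : HeegaardDiagram o d la lb) {M : Type} [TopologicalSpace M] (e : D.manifold ≃ₜ M)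

/-- The inclusion of the Heegaard surface at the level `h`. -/
def levelMap (h : Interval) (x : S) : M := e (Manifold.mk D.α D.β (.inl (x, h)))

theorem continuous_levelMap (h : Interval) : Continuous (D.levelMap e h) :=
  e.continuous.comp ((Manifold.continuous_mk _ _).comp
    (continuous_inl.comp (by fun_prop)))

/-- The `β`-arcs cut `R₊` into disks, hence there is a potential outside the `β`-tubes. -/
theorem exists_outerPotential :
    ∃ a, D.β.IsOuterPotential (D.levelMap e ⟨1, by simp⟩) a := by
  obtain ⟨a, ha⟩ := D.cut_β.exists_potential e.continuous
  refine ⟨fun x => a (Manifold.mk D.α D.β (.inl (x, ⟨1, by simp⟩))), fun γ u v huv hγ hγN => ?_⟩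
  refine ha (fun t => Manifold.mk D.α D.β (.inl (γ t, ⟨1, by simp⟩))) u v huv ?_ fun t ht => ?_
  · exact (Manifold.continuous_mk _ _).comp_continuousOn
      (continuous_inl.comp_continuousOn (hγ.prodMk continuousOn_const))
  · have h := hγN ht
    rw [mem_compl_iff, mem_union, not_or] at h
    refine ⟨.inl ⟨γ t, h.1, rfl⟩, ?_⟩
    rintro ⟨x, hx, hxt⟩
    exact h.2 (Manifold.mk_upper_injective D.α D.β hxt ▸ hx)

/-- A loop in the Heegaard surface can be pushed from one level to another. -/
theorem seg_levelMap {c : ℝ → S} (hc : Continuous c) (hper : c 1 = c 0) (h h' : Interval) :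
    seg (D.levelMap e h ∘ c) 0 1 = seg (D.levelMap e h' ∘ c) 0 1 := by
  let H : ℝ × ℝ → M := fun z => D.levelMap e (projIcc (-1) 1 (by norm_num) z.2) (c z.1)
  have hH : Continuous H := e.continuous.comp ((Manifold.continuous_mk _ _).comp
    (continuous_inl.comp ((hc.comp continuous_fst).prodMk
      (continuous_projIcc.comp continuous_snd))))
  have e1 := seg_add_seg (F := H) convex_univ hH.continuousOn
    (mem_univ (0, (h : ℝ))) (mem_univ (1, (h : ℝ))) (mem_univ (1, (h' : ℝ)))
  have e2 := seg_add_seg (F := H) convex_univ hH.continuousOn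
    (mem_univ (0, (h : ℝ))) (mem_univ (0, (h' : ℝ))) (mem_univ (1, (h' : ℝ)))
  have e3 : seg H (1, (h : ℝ)) (1, (h' : ℝ)) = seg H (0, (h : ℝ)) (0, (h' : ℝ)) :=
    seg_congr fun x y _ _ hxy => by simp [H, hxy, hper]
  have e4 : ∀ h : Interval, seg H (0, (h : ℝ)) (1, (h : ℝ)) = seg (D.levelMap e h ∘ c) 0 1 :=
    fun h => seg_congr fun x y _ _ hxy => by
      have : x * (h : ℝ) + y * h = h := by rw [← add_mul, hxy, one_mul]
      simp [H, this, projIcc_val]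
  rw [← e4, ← e4]
  rw [e3, ← e2, add_comm] at e1
  exact add_left_cancel e1

theorem TransverseLoop.toChains_homologyClass (c : D.TransverseLoop) :
    H1.toChains (c.homologyClass D e) = seg (D.levelMap e ⟨0, by simp⟩ ∘ c.toFun) 0 1 :=
  H1.toChains_loopClass_eq_seg _ _

theorem continuous_circle (C : CurveSystem o d la) (i : Fin d) :
    Continuous (C.curve (.inl i)) ∧
      ∀ τ, MDifferentiableAt 𝓘(ℝ, ℝ) (𝓡∂ 2) (C.curve (.inl i)) τ := by
  have h0 : (0 : ℝ) ∈ Ioo (-2 : ℝ) 2 := by constructor <;> norm_num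
  have hd : ∀ τ, MDifferentiableAt 𝓘(ℝ, ℝ) (𝓡∂ 2) (C.curve (.inl i)) τ := fun τ => by
    have hs := (C.tube_interior (k := .inl i) (z := (τ, 0)) ⟨mem_univ _, h0⟩
      ((C.circle i).interior τ 0 h0)).2.1
    refine (hs.mdifferentiableAt (by simp)).comp (I := 𝓘(ℝ, ℝ)) (x := τ)
      (f := fun t : ℝ => (t, (0 : ℝ))) ?_
    exact DifferentiableAt.mdifferentiableAt (by fun_prop)
  exact ⟨continuous_iff_continuousAt.2 fun τ => (hd τ).continuousAt, hd⟩

/-- A closed `α`-curve bounds a disk in the handle attached along it. -/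
theorem seg_circle_α (i : Fin d) :
    seg (D.levelMap e ⟨-1, by simp⟩ ∘ D.α.curve (.inl i)) 0 1 = 0 := by
  classical
  -- the core disk of the handle, extended by a constant
  let Ψ : ℂ → M := fun z => if hz : z ∈ Metric.closedBall (0 : ℂ) 1 then
    e (Manifold.mk D.α D.β (.inr (.inl (i, ⟨z, hz⟩, ⟨0, by simp⟩)))) else
    e (Manifold.mk D.α D.β (.inr (.inl (i, Disk.bdry 0, ⟨0, by simp⟩))))
  have hΨ : ContinuousOn Ψ (Metric.closedBall (0 : ℂ) 1) := by
    rw [continuousOn_iff_continuous_domRestrict]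
    have : (Metric.closedBall (0 : ℂ) 1).domRestrict Ψ = fun z =>
        e (Manifold.mk D.α D.β (.inr (.inl (i, z, ⟨0, by simp⟩)))) := by
      funext z
      exact dif_pos z.2
    rw [this]
    exact e.continuous.comp ((Manifold.continuous_mk _ _).comp (by fun_prop))
  have hγ : Continuous fun t : ℝ => (Disk.bdry t : ℂ) := by
    unfold Disk.bdry
    fun_prop
  have e1 : seg (D.levelMap e ⟨-1, by simp⟩ ∘ D.α.curve (.inl i)) 0 1 =
      seg (Ψ ∘ fun t : ℝ => (Disk.bdry t : ℂ)) (0 : ℝ) 1 := by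
    refine seg_congr fun x y _ _ _ => ?_
    have : Ψ (Disk.bdry (x • 0 + y • 1)) = _ := dif_pos (Disk.bdry (x • 0 + y • 1)).2
    rw [Function.comp, Function.comp, this]
    exact congrArg e (Quot.sound (Glue.lower i (x • 0 + y • 1) ⟨0, by simp⟩)).symm
  rw [e1, seg_comp (convex_closedBall (0 : ℂ) 1) hΨ zero_le_one hγ.continuousOn
    fun t _ => (Disk.bdry t).2]
  have : (Disk.bdry 1 : ℂ) = (Disk.bdry 0 : ℂ) := by
    simp [Disk.bdry, Complex.exp_two_pi_mul_I]
  rw [this, seg_self]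

theorem crossing_area_ne_zero (x : D.Cr) :
    o.area (D.α.curve x.i x.t) (velocity (D.α.curve x.i) x.t)
      (velocity (D.β.curve x.j) x.u) ≠ 0 :=
  (D.transverse x.i x.j x.t (Ico_subset_Icc_self x.ht) x.u (Ico_subset_Icc_self x.hu) x.meet).2

theorem crossingSign_ne_zero (x : D.Cr) : D.crossingSign x ≠ 0 :=
  sign_ne_zero.2 (D.crossing_area_ne_zero x)

/-- The class `E_j` is the dual class `β*_j`. -/
theorem toChains_dual [T2Space S] {βdual : Fin d ⊕ Fin lb → H1 M} (hβ : D.IsDualFamily e βdual)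
    {a : S → Chains1 M} (ha : D.β.IsOuterPotential (D.levelMap e ⟨1, by simp⟩) a)
    (j : Fin d ⊕ Fin lb) :
    H1.toChains (βdual j) = D.β.crossingClass (D.levelMap e ⟨1, by simp⟩) a j := by
  classical
  obtain ⟨c, hc, hcj⟩ := hβ j
  have hper : c.toFun 1 = c.toFun 0 := by simpa using c.periodic 0
  rw [← hcj, TransverseLoop.toChains_homologyClass,
    D.seg_levelMap e c.smooth.continuous hper _ ⟨1, by simp⟩,
    CurveSystem.seg_loop_eq_sum (D.continuous_levelMap e _) ha c.smooth.continuous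
      (fun τ => c.smooth.mdifferentiable (by simp) τ) c.periodic c.interior
      (X := Finset.univ.sigma fun k => (c.finite_meet k).toFinset) (τ := fun x => x.2.1)
      (u := fun x => x.2.2) (κ := fun x => x.1), Finset.sum_sigma]
  · have : ∀ k, ∑ p ∈ (c.finite_meet k).toFinset, (SignType.sign (o.area (c.toFun p.1)
        (velocity c.toFun p.1) (velocity (D.β.curve k) p.2)) : ℤ) •
          D.β.crossingClass (D.levelMap e ⟨1, by simp⟩) a k =
        (if k = j then 1 else 0 : ℤ) • D.β.crossingClass (D.levelMap e ⟨1, by simp⟩) a k :=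
      fun k => by
        rw [← hc k]
        exact (map_sum (zmultiplesHom _ (D.β.crossingClass (D.levelMap e ⟨1, by simp⟩) a k))
          _ _).symm
    simp only [this]
    simp
  · intro x hx
    simpa using hx
  · intro t ht k v hv h
    exact ⟨⟨k, t, v⟩, by simpa using ⟨ht, hv, h⟩, rfl⟩
  · rintro ⟨k, p⟩ _ ⟨k', p'⟩ _ h1 h2 h3
    obtain rfl : k = k' := h2
    obtain rfl : p = p' := Prod.ext h1 h3
    rfl
  · intro x hx
    have hx' : x.2 ∈ (c.finite_meet x.1).toFinset := (Finset.mem_sigma.1 hx).2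
    rw [Set.Finite.mem_toFinset] at hx'
    exact c.transverse _ _ _ (Ico_subset_Icc_self hx'.2.1) hx'.2.2

/-- The signed sum in `H₁(M)` of the dual classes met along a closed `α`-curve vanishes, because
the curve bounds a disk. -/
theorem sum_crossings_eq_zero [T2Space S] {βdual : Fin d ⊕ Fin lb → H1 M}
    (hβ : D.IsDualFamily e βdual) (i : Fin d) :
    ∑ x : D.Cr with x.i = .inl i, (D.crossingSign x : ℤ) • βdual x.j = 0 := by
  classical
  obtain ⟨a, ha⟩ := D.exists_outerPotential e
  apply H1.toChains_injective
  have h0 : (0 : ℝ) ∈ Ioo (-2 : ℝ) 2 := by constructor <;> norm_num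
  obtain ⟨hc, hd⟩ := continuous_circle D.α i
  have hper : ∀ t, D.α.curve (.inl i) (t + 1) = D.α.curve (.inl i) t := fun t =>
    (D.α.circle i).periodic t 0
  have hsum := CurveSystem.seg_loop_eq_sum (D.continuous_levelMap e _) ha hc hd hper
    (fun t => (D.α.circle i).interior t 0 h0) (X := Finset.univ.filter fun x : D.Cr => x.i = .inl i)
    (τ := fun x => x.t) (u := fun x => x.u) (κ := fun x => x.j)
    (fun x hx => ⟨x.ht, x.hu, by rw [← (Finset.mem_filter.1 hx).2]; exact x.meet⟩)
    (fun t ht k v hv h => ⟨⟨.inl i, k, t, v, ht, hv, h⟩, by simp, rfl⟩)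
    (fun x hx y hy h1 h2 h3 => by
      cases x; cases y
      simp only [Finset.mem_filter] at hx hy
      simp_all)
    (fun x hx => by
      have := D.crossing_area_ne_zero x
      rwa [(Finset.mem_filter.1 hx).2] at this)
  rw [← D.seg_levelMap e hc (by simpa using hper 0) ⟨-1, by simp⟩, D.seg_circle_α e i] at hsum
  rw [map_sum, map_zero, hsum]
  refine Finset.sum_congr rfl fun x hx => ?_
  rw [map_zsmul, D.toChains_dual e hβ ha, crossingSign, (Finset.mem_filter.1 hx).2]

end HeegaardDiagram

end Relation

/-! ### Structure maps of `H_n` on the homogeneous basis -/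

section Basis

variable (n : ℕ)

theorem Kpow_zero : Kpow n 0 = 1 := rfl

theorem Kpow_add (a b : ZMod n) : Kpow n (a + b) = Kpow n a * Kpow n b :=
  map_mul (MonoidAlgebra.of ℂ (Multiplicative (ZMod n))) (.ofAdd a) (.ofAdd b)

theorem bas_zero (a : ZMod n) : bas n (a, 0) = TrivSqZeroExt.inl (Kpow n a) := by
  simp [bas]

theorem bas_one (a : ZMod n) : bas n (a, 1) = TrivSqZeroExt.inr (Kpow n a) := by
  rw [bas]
  ext
  · simp
  · simp

/-- Evaluation of algebra maps at `K^a`, as a homomorphism from `G(B*)` to `ℂ`. -/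
def evalKpow (a : ZMod n) : GBdual n →* ℂ where
  toFun f := f.ofConv (Kpow n a)
  map_one' := by
    change (1 : GBdual n) (Kpow n a) = 1
    rw [AlgHom.convOne_apply]
    simp [Kpow]
  map_mul' f g := by
    change (f * g) (Kpow n a) = f (Kpow n a) * g (Kpow n a)
    rw [AlgHom.convMul_apply]
    simp [Kpow]

theorem evalKpow_zero (f : GBdual n) : evalKpow n 0 f = 1 := map_one f.ofConv

theorem evalKpow_add (a b : ZMod n) (f : GBdual n) :
    evalKpow n (a + b) f = evalKpow n a f * evalKpow n b f := by
  change f.ofConv _ = f.ofConv _ * f.ofConv _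
  rw [Kpow_add, map_mul]

theorem evalKpow_neg (a : ZMod n) (f : GBdual n) : evalKpow n (-a) f = (evalKpow n a f)⁻¹ := by
  refine eq_inv_of_mul_eq_one_left ?_
  rw [← evalKpow_add, neg_add_cancel, evalKpow_zero]

/-- The homomorphism `H_n = B[X]/(X²) → ℂ[X]/(X²)` induced by an algebra map `f : B → ℂ`. Its two
components are `f ∘ π_B` and `f ∘ μ`. -/
def dualEval (f : GBdual n) : Hn n →* DualNumber ℂ where
  toFun h := TrivSqZeroExt.inl (f.ofConv h.fst) + TrivSqZeroExt.inr (f.ofConv h.snd)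
  map_one' := by simp
  map_mul' h k := by
    ext <;> simp

theorem dualEval_bas (f : GBdual n) (b : Idx n) :
    dualEval n f (bas n b) = TrivSqZeroExt.inl (evalKpow n b.1 f) * DualNumber.eps ^ (b.2 : ℕ) := by
  obtain ⟨b, e⟩ := b
  fin_cases e
  · ext <;> simp [dualEval, bas_zero, evalKpow]
  · rw [Fin.mk_one, bas_one]
    ext <;> simp [dualEval, evalKpow, -DualNumber.inr_eq_smul_eps]

theorem fst_inl_mul_eps_pow (w : ℂ) (k : ℕ) :
    (TrivSqZeroExt.inl w * DualNumber.eps ^ k : DualNumber ℂ).fst = if k = 0 then w else 0 := by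
  rcases k with _ | k <;> simp [TrivSqZeroExt.fst_pow]

theorem snd_inl_mul_eps_pow (w : ℂ) (k : ℕ) :
    (TrivSqZeroExt.inl w * DualNumber.eps ^ k : DualNumber ℂ).snd = if k = 1 then w else 0 := by
  rcases k with _ | _ | k
  · simp
  · simp
  · simp [pow_succ, mul_assoc, DualNumber.eps_mul_eps]

theorem coord_bas (b c : Idx n) : coord n b (bas n c) = if b = c then 1 else 0 := by
  obtain ⟨b, e⟩ := b
  obtain ⟨c, f⟩ := c
  fin_cases e <;> fin_cases f <;> simp [coord, bas_zero, bas_one, Kpow]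
  all_goals
    rw [Finsupp.single_apply]
    simp [eq_comm]

variable [NeZero n]

/-- The powers of `K` span `B`. -/
theorem Bn_eq_sum (b : Bn n) :
    ∑ a : ZMod n, b.coeff (Multiplicative.ofAdd a) • Kpow n a = b := by
  ext a
  simp only [Kpow, MonoidAlgebra.of_apply, MonoidAlgebra.smul_single, smul_eq_mul, mul_one,
    MonoidAlgebra.coeff_sum, MonoidAlgebra.coeff_single, Finsupp.coe_finsetSum, Finset.sum_apply]
  rw [Finset.sum_eq_single (Multiplicative.toAdd a)]
  · exact Finsupp.single_eq_same
  · exact fun c _ hc => Finsupp.single_eq_of_ne fun h => hc (by rw [h]; rfl)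
  · simp

theorem ofBasis_bas {V : Type} [AddCommGroup V] [Module ℂ V] (f : Idx n → V) (b : Idx n) :
    ofBasis n f (bas n b) = f b := by
  simp [ofBasis, coord_bas]

/-- The relative integral is the coefficient of `X`. -/
theorem relIntegral_eq (h : Hn n) : relIntegral n h = h.snd := by
  simp [relIntegral, ofBasis, Fintype.sum_prod_type, coord]
  exact Bn_eq_sum n _

theorem projB_eq (h : Hn n) : projB n h = h.fst := by
  simp [projB, ofBasis, Fintype.sum_prod_type, coord]
  exact Bn_eq_sum n _

theorem iterComul_cons_tmul (b : Idx n) (L : List (Idx n)) (x y : Hn n) :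
    iterComul n L ((TensorProduct.lid ℂ (Hn n)) ((coord n b).rTensor (Hn n) (x ⊗ₜ[ℂ] y))) =
      coord n b x * iterComul n L y := by
  rw [LinearMap.rTensor_tmul, TensorProduct.lid_tmul, LinearMap.map_smul, smul_eq_mul]

theorem iterComul_cons_zero (b : Idx n) (L : List (Idx n)) (a : ZMod n) :
    iterComul n (b :: L) (bas n (a, 0)) =
      (if b = (a, 0) then 1 else 0) * iterComul n L (bas n (a, 0)) := by
  rw [← coord_bas, ← iterComul_cons_tmul]
  simp only [iterComul, comul, LinearMap.comp_apply, ofBasis_bas, if_true]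
  rfl

/-- The two terms come from `Δ(K^a X) = K^{a+1} ⊗ K^a X + K^a X ⊗ K^a`. -/
theorem iterComul_cons_one (b : Idx n) (L : List (Idx n)) (a : ZMod n) :
    iterComul n (b :: L) (bas n (a, 1)) =
      (if b = (a + 1, 0) then 1 else 0) * iterComul n L (bas n (a, 1)) +
      (if b = (a, 1) then 1 else 0) * iterComul n L (bas n (a, 0)) := by
  rw [← coord_bas, ← coord_bas, ← iterComul_cons_tmul, ← iterComul_cons_tmul,
    ← LinearMap.map_add (iterComul n L), ← LinearEquiv.map_add, ← LinearMap.map_add]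
  simp only [iterComul, comul, LinearMap.comp_apply, ofBasis_bas, one_ne_zero, if_false]
  rfl

theorem iterComul_nil (b : Idx n) :
    iterComul n [] (bas n b) = if b.2 = 0 then 1 else 0 := by
  simp [iterComul, counit, ofBasis_bas]

end Basis

/-! ### Iterated coproducts -/

section IteratedCoproduct

variable (n : ℕ) {ι : Type} [DecidableEq ι]

/-- The labels of the legs in the term of `Δ^{(k)}(K^a X)` whose odd factor `K^a X` is on the leg
`x`: the legs before `x` carry `K^{a+1}` and the legs after `x` carry `K^a`. -/
def oddLabel (L : List ι) (a : ZMod n) (x y : ι) : Idx n :=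
  if y = x then (a, 1) else if L.idxOf y < L.idxOf x then (a + 1, 0) else (a, 0)

theorem oddLabel_cons_self {z : ι} {L : List ι} (hz : z ∉ L) (a : ZMod n) {y : ι} (hy : y ∈ L) :
    oddLabel n (z :: L) a z y = (a, 0) := by
  have hyz : y ≠ z := fun h => hz (h ▸ hy)
  simp [oddLabel, hyz]

theorem oddLabel_cons_head {z : ι} {L : List ι} (hz : z ∉ L) (a : ZMod n) {x : ι} (hx : x ∈ L) :
    oddLabel n (z :: L) a x z = (a + 1, 0) := by
  have hxz : z ≠ x := fun h => hz (h ▸ hx)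
  simp [oddLabel, hxz, List.idxOf_cons_ne]

theorem oddLabel_cons {z : ι} {L : List ι} (hz : z ∉ L) (a : ZMod n) {x y : ι} (hx : x ∈ L)
    (hy : y ∈ L) : oddLabel n (z :: L) a x y = oddLabel n L a x y := by
  have hxz : z ≠ x := fun h => hz (h ▸ hx)
  have hyz : z ≠ y := fun h => hz (h ▸ hy)
  simp [oddLabel, hxz, hyz, List.idxOf_cons_ne]

variable [NeZero n]

/-- `Δ^{(k)}(K^a) = K^a ⊗ ⋯ ⊗ K^a`, in coordinates. -/
theorem iterComul_map_even {L : List ι} (hL : L.Nodup) (s : ι → Idx n) (a : ZMod n) :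
    iterComul n (L.map s) (bas n (a, 0)) =
      ∏ y ∈ L.toFinset, if s y = (a, 0) then 1 else 0 := by
  rw [List.prod_toFinset _ hL]
  induction L with
  | nil => simp [iterComul_nil]
  | cons z L ih =>
    rw [List.map_cons, iterComul_cons_zero, ih (List.nodup_cons.1 hL).2, List.map_cons,
      List.prod_cons]

/-- `Δ^{(k)}(K^a X)` is the sum over the position of its odd factor, in coordinates. -/
theorem iterComul_map_odd {L : List ι} (hL : L.Nodup) (s : ι → Idx n) (a : ZMod n) :
    iterComul n (L.map s) (bas n (a, 1)) = ∑ x ∈ L.toFinset, ∏ y ∈ L.toFinset,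
      if s y = oddLabel n L a x y then 1 else 0 := by
  induction L with
  | nil => simp [iterComul_nil]
  | cons z L ih =>
    obtain ⟨hz, hL'⟩ := List.nodup_cons.1 hL
    have hz' : z ∉ L.toFinset := by simpa using hz
    rw [List.map_cons, iterComul_cons_one, ih hL', iterComul_map_even n hL', List.toFinset_cons,
      Finset.sum_insert hz', Finset.prod_insert hz', add_comm]
    congr 1
    · congr 1
      · simp [oddLabel]
      · refine Finset.prod_congr rfl fun y hy => ?_
        rw [oddLabel_cons_self n hz a (List.mem_toFinset.1 hy)]
    · rw [Finset.mul_sum]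
      refine Finset.sum_congr rfl fun x hx => ?_
      rw [Finset.prod_insert hz', oddLabel_cons_head n hz a (List.mem_toFinset.1 hx)]
      congr 1
      refine Finset.prod_congr rfl fun y hy => ?_
      rw [oddLabel_cons n hz a (List.mem_toFinset.1 hx) (List.mem_toFinset.1 hy)]

end IteratedCoproduct

/-! ### Fox derivatives of words -/

section FoxWord

variable {ι κ : Type} [DecidableEq ι] [DecidableEq κ]

theorem fox_one (j : κ) : fox j (1 : FreeGroup κ) = 0 := by
  have h := fox_mul j (1 : FreeGroup κ) 1
  rw [mul_one, map_one, one_mul] at h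
  exact left_eq_add.1 h

theorem fox_inv (j : κ) (u : FreeGroup κ) :
    fox j u⁻¹ = -(MonoidAlgebra.of ℤ _ u⁻¹ * fox j u) := by
  have h := fox_mul j u⁻¹ u
  rw [inv_mul_cancel, fox_one] at h
  exact eq_neg_of_add_eq_zero_left h.symm

/-- The contribution of the letter `x` to the Fox derivative of a word `∏ q_y ^ m_y`, evaluated at
nonzero scalars `q_y`: the value of the prefix before `x`, times `-q_x⁻¹` if `m_x = -1`. -/
def foxTerm (q : ι → ℂ) (m : ι → SignType) (L : List ι) (x : ι) : ℂ :=
  ∏ y ∈ L.toFinset, if y = x then (if m y = -1 then -(q y)⁻¹ else 1) else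
    if L.idxOf y < L.idxOf x then q y ^ (m y : ℤ) else 1

theorem foxTerm_cons_self (q : ι → ℂ) (m : ι → SignType) {z : ι} {L : List ι} (hz : z ∉ L) :
    foxTerm q m (z :: L) z = if m z = -1 then -(q z)⁻¹ else 1 := by
  have hz' : z ∉ L.toFinset := by simpa using hz
  rw [foxTerm, List.toFinset_cons, Finset.prod_insert hz', if_pos rfl, Finset.prod_eq_one, mul_one]
  intro y hy
  have hyz : y ≠ z := fun h => hz' (h ▸ hy)
  simp [hyz]

theorem foxTerm_cons (q : ι → ℂ) (m : ι → SignType) {z x : ι} {L : List ι} (hz : z ∉ L)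
    (hx : x ∈ L) : foxTerm q m (z :: L) x = q z ^ (m z : ℤ) * foxTerm q m L x := by
  have hz' : z ∉ L.toFinset := by simpa using hz
  have hxz : z ≠ x := fun h => hz (h ▸ hx)
  rw [foxTerm, List.toFinset_cons, Finset.prod_insert hz', if_neg hxz, if_pos]
  · congr 1
    refine Finset.prod_congr rfl fun y hy => ?_
    have hyz : z ≠ y := fun h => hz' (h ▸ hy)
    simp [hxz, hyz, List.idxOf_cons_ne]
  · simp [hxz, List.idxOf_cons_ne]

/-- The image of the Fox derivative of a word is the sum of the contributions of its letters `j`. -/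
theorem fox_word (φ : MonoidAlgebra ℤ (FreeGroup κ) →+* ℂ) (q : κ → ℂ)
    (hq : ∀ k, φ (MonoidAlgebra.of ℤ _ (FreeGroup.of k)) = q k) (f : ι → κ) (m : ι → SignType)
    (hm : ∀ x, m x ≠ 0) (j : κ) {L : List ι} (hL : L.Nodup) :
    φ (fox j (L.map fun x => FreeGroup.of (f x) ^ (m x : ℤ)).prod) =
      ∑ x ∈ L.toFinset with f x = j, foxTerm (fun y => q (f y)) m L x := by
  have hinv : ∀ k, φ (MonoidAlgebra.of ℤ _ (FreeGroup.of k)⁻¹) = (q k)⁻¹ := fun k => by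
    refine eq_inv_of_mul_eq_one_left ?_
    rw [← hq, ← map_mul, ← map_mul, inv_mul_cancel, map_one, map_one]
  have hsign : ∀ x, m x = 1 ∨ m x = -1 := fun x => by
    have := hm x
    revert this
    cases m x <;> simp
  induction L with
  | nil => simp [fox_one]
  | cons z L ih =>
    obtain ⟨hz, hL'⟩ := List.nodup_cons.1 hL
    have hz' : z ∉ L.toFinset := by simpa using hz
    have hhead : φ (MonoidAlgebra.of ℤ _ (FreeGroup.of (f z) ^ (m z : ℤ))) =
        q (f z) ^ (m z : ℤ) := by
      rcases hsign z with h | h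
      · simp only [h, SignType.coe_one, zpow_one]
        exact hq _
      · have := hinv (f z)
        simp only [h, SignType.coe_neg_one, zpow_neg_one]
        exact this
    have hfox : φ (fox j (FreeGroup.of (f z) ^ (m z : ℤ))) =
        if f z = j then (if m z = -1 then -(q (f z))⁻¹ else 1) else 0 := by
      rcases hsign z with h | h
      · have h1 : ((m z : SignType) : ℤ) = 1 := by rw [h]; rfl
        rw [h1, zpow_one, fox_of, h]
        split_ifs <;> simp_all
      · have h1 : ((m z : SignType) : ℤ) = -1 := by rw [h]; rfl
        rw [h1, zpow_neg_one, fox_inv, fox_of, h, map_neg, map_mul, hinv]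
        split_ifs <;> simp_all
    rw [List.map_cons, List.prod_cons, fox_mul, map_add, map_mul, hhead, hfox, ih hL',
      List.toFinset_cons, Finset.filter_insert]
    have hrest : ∑ x ∈ L.toFinset with f x = j, foxTerm (fun y => q (f y)) m (z :: L) x =
        q (f z) ^ (m z : ℤ) * ∑ x ∈ L.toFinset with f x = j, foxTerm (fun y => q (f y)) m L x := by
      rw [Finset.mul_sum]
      refine Finset.sum_congr rfl fun x hx => ?_
      exact foxTerm_cons _ m hz (List.mem_toFinset.1 (Finset.mem_filter.1 hx).1)
    split_ifs with h1 h2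
    · rw [Finset.sum_insert (by simp [hz]), hrest, foxTerm_cons_self _ m hz, if_pos h2]
    · rw [Finset.sum_insert (by simp [hz]), hrest, foxTerm_cons_self _ m hz, if_neg h2]
    · rw [hrest, zero_add]

end FoxWord

/-! ### Contraction of the tensors -/

section Contraction

variable {S : Type} [TopologicalSpace S] [ChartedSpace (EuclideanHalfSpace 2) S]
  [IsManifold (𝓡∂ 2) ∞ S]
variable {o : SurfaceOrientation S} {d la lb : ℕ} (D : HeegaardDiagram o d la lb)
  (n : ℕ)

/-- The scalar by which a leg with label `b` at a crossing of sign `m` contributes to the value of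
a `β`-curve with algebra map `f`. At a negative crossing it comes from `S(K^a) = K^{-a}` and
`S(K^a X) = -K^{-a-1} X`. -/
def legValue (f : GBdual n) (m : SignType) (b : Idx n) : ℂ :=
  if m = -1 then (if b.2 = 0 then evalKpow n (-b.1) f else -evalKpow n (-b.1 - 1) f)
  else evalKpow n b.1 f

theorem SignType.eq_of_ne_zero {m : SignType} (hm : m ≠ 0) : m = 1 ∨ m = -1 := by
  revert hm; cases m <;> simp

theorem legValue_even (f : GBdual n) {m : SignType} (hm : m ≠ 0) (a : ZMod n) :
    legValue n f m (a, 0) = evalKpow n a f ^ (m : ℤ) := by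
  rcases SignType.eq_of_ne_zero hm with rfl | rfl
  · simp [legValue]
  · simp [legValue, evalKpow_neg]

theorem legValue_odd (f : GBdual n) {m : SignType} (hm : m ≠ 0) (a : ZMod n) :
    legValue n f m (a, 1) =
      evalKpow n a f ^ (m : ℤ) * if m = -1 then -(evalKpow n 1 f)⁻¹ else 1 := by
  rcases SignType.eq_of_ne_zero hm with rfl | rfl
  · simp [legValue]
  · simp [legValue, evalKpow_neg, sub_eq_add_neg, evalKpow_add]

theorem legValue_oddLabel {ι : Type} [DecidableEq ι] (L : List ι) (f : GBdual n) {m : SignType}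
    (hm : m ≠ 0) (a : ZMod n) (x y : ι) :
    legValue n f m (oddLabel n L a x y) = evalKpow n a f ^ (m : ℤ) *
      if y = x then (if m = -1 then -(evalKpow n 1 f)⁻¹ else 1) else
        if L.idxOf y < L.idxOf x then evalKpow n 1 f ^ (m : ℤ) else 1 := by
  unfold oddLabel
  split_ifs
  · rw [legValue_odd n f hm, if_pos ‹_›]
  · rw [legValue_odd n f hm, if_neg ‹_›]
  · rw [legValue_even n f hm, evalKpow_add, mul_zpow]
  · rw [legValue_even n f hm, mul_one]

namespace HeegaardDiagram

theorem nodup_alongα (i : Fin d ⊕ Fin la) : (D.alongα i).Nodup :=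
  (List.perm_insertionSort _ _).nodup_iff.2 (Finset.nodup_toList _)

theorem nodup_alongβ (j : Fin d ⊕ Fin lb) : (D.alongβ j).Nodup :=
  (List.perm_insertionSort _ _).nodup_iff.2 (Finset.nodup_toList _)

open Classical in
theorem toFinset_alongα (i : Fin d ⊕ Fin la) :
    (D.alongα i).toFinset = Finset.univ.filter fun x : D.Cr => x.i = i := by
  ext x; simp [alongα]

open Classical in
theorem toFinset_alongβ (j : Fin d ⊕ Fin lb) :
    (D.alongβ j).toFinset = Finset.univ.filter fun x : D.Cr => x.j = j := by
  ext x; simp [alongβ]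

/-- If the odd legs are at one crossing `pos i` on each closed `α`-curve and these crossings lie
on the curves `β_{σ i}`, the Koszul sign is the sign of the permutation `σ`. -/
theorem koszulSign_eq_sign {s : D.Cr → Idx n} {pos : Fin d → D.Cr} {σ : Equiv.Perm (Fin d)}
    (hpos : ∀ i, (pos i).i = .inl i) (hσ : ∀ i, (pos i).j = .inl (σ i))
    (hs : ∀ i, (s (pos i)).2 = 1) (hs' : ∀ x ∉ Set.range pos, (s x).2 = 0) :
    D.koszulSign n s = ((Equiv.Perm.sign σ : ℤ) : ℂ) := by
  classical
  have hinj : Function.Injective pos := fun i i' h => by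
    have := congrArg Crossing.i h
    rw [hpos, hpos] at this
    exact Sum.inl_injective this
  rw [Equiv.Perm.sign_eq_prod_prod_Ioi]
  push_cast
  unfold koszulSign
  symm
  refine Fintype.prod_of_injective pos hinj _ _ (fun x hx => ?_) fun i => ?_
  · exact Finset.prod_eq_one fun y _ => by simp [hs' x hx]
  rw [← Fintype.prod_of_injective pos hinj (fun i' => if i < i' ∧ σ i' < σ i then (-1 : ℂ) else 1)]
  · rw [← Finset.prod_subset (Finset.subset_univ (Finset.Ioi i))]
    · refine Finset.prod_congr rfl fun i' hi' => ?_
      have hlt := Finset.mem_Ioi.1 hi'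
      have hne : σ i' ≠ σ i := fun h => hlt.ne' (σ.injective h)
      by_cases h : σ i < σ i'
      · simp [h, h.not_gt]
      · simp [h, hlt, lt_of_le_of_ne (not_lt.1 h) hne]
    · intro i' _ hi'
      rw [if_neg fun h => hi' (Finset.mem_Ioi.2 h.1)]
  · intro y hy
    simp [hs' y hy]
  · intro i'
    have hα : D.Beforeα (pos i) (pos i') ↔ i < i' := by
      rw [Beforeα, hpos, hpos, Sum.Lex.inl_lt_inl_iff]
      refine ⟨?_, .inl⟩
      rintro (h | ⟨h, h'⟩)
      · exact h
      · rw [Sum.inl_injective h] at h'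
        exact absurd h' (lt_irrefl _)
    have hβ : i < i' → (D.Beforeβ (pos i') (pos i) ↔ σ i' < σ i) := fun hlt => by
      rw [Beforeβ, hσ, hσ, Sum.Lex.inl_lt_inl_iff]
      refine ⟨?_, .inl⟩
      rintro (h | ⟨h, h'⟩)
      · exact h
      · exact absurd (σ.injective (Sum.inl_injective h)) hlt.ne'
    by_cases hlt : i < i'
    · simp [hα, hβ hlt, hs, hlt]
    · simp [hα, hlt]

variable [NeZero n]

theorem dualEval_crossingTensor (f : GBdual n) (x : D.Cr) (b : Idx n) :
    dualEval n f (D.crossingTensor n x b) =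
      TrivSqZeroExt.inl (legValue n f (D.crossingSign x) b) * DualNumber.eps ^ (b.2 : ℕ) := by
  obtain ⟨a, e⟩ := b
  have hneg : ∀ h : Hn n, dualEval n f (-h) = -dualEval n f h := fun h => by
    ext <;> simp [dualEval]
  unfold crossingTensor legValue
  split_ifs with h1 h2
  · obtain rfl : e = 0 := h2
    rw [antipode, ofBasis_bas, if_pos rfl, dualEval_bas]
  · obtain rfl : e = 1 := Fin.eq_one_of_ne_zero e h2
    rw [antipode, ofBasis_bas, if_neg h2, hneg, dualEval_bas, TrivSqZeroExt.inl_neg, neg_mul]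
  · exact dualEval_bas n f _

open Classical in
/-- The image in the dual numbers of the product along a `β`-curve: the exponent of `ε` is the
number of odd factors. -/
theorem dualEval_productAlong (f : GBdual n) (s : D.Cr → Idx n) (j : Fin d ⊕ Fin lb) :
    dualEval n f (D.productAlong n s j) =
      TrivSqZeroExt.inl (∏ x : D.Cr with x.j = j, legValue n f (D.crossingSign x) (s x)) *
        DualNumber.eps ^ (∑ x : D.Cr with x.j = j, ((s x).2 : ℕ)) := by
  rw [productAlong, map_list_prod, List.map_map, ← List.prod_toFinset _ (D.nodup_alongβ j),
    toFinset_alongβ]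
  simp only [Function.comp, dualEval_crossingTensor]
  rw [Finset.prod_mul_distrib, Finset.prod_pow_eq_pow_sum]
  congr 1
  exact (map_prod (TrivSqZeroExt.inlHom ℂ ℂ) _ _).symm

open Classical in
theorem relIntegral_productAlong (f : GBdual n) (s : D.Cr → Idx n) (j : Fin d ⊕ Fin lb) :
    f.ofConv (relIntegral n (D.productAlong n s j)) =
      if ∑ x : D.Cr with x.j = j, ((s x).2 : ℕ) = 1 then
        ∏ x : D.Cr with x.j = j, legValue n f (D.crossingSign x) (s x) else 0 := by
  rw [← snd_inl_mul_eps_pow, ← dualEval_productAlong, relIntegral_eq]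
  simp [dualEval]

open Classical in
theorem projB_productAlong (f : GBdual n) (s : D.Cr → Idx n) (j : Fin d ⊕ Fin lb) :
    f.ofConv (projB n (D.productAlong n s j)) =
      if ∑ x : D.Cr with x.j = j, ((s x).2 : ℕ) = 0 then
        ∏ x : D.Cr with x.j = j, legValue n f (D.crossingSign x) (s x) else 0 := by
  rw [← fst_inl_mul_eps_pow, ← dualEval_productAlong, projB_eq]
  simp [dualEval]

end HeegaardDiagram

end Contraction

/-! ### The state sum -/

theorem sum_zmod_product (n : ℕ) [NeZero n] {ι : Type*} (s : Finset ι) (f : ι → ℂ) :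
    ∑ q ∈ (Finset.univ : Finset (ZMod n)) ×ˢ s, (n : ℂ)⁻¹ * f q.2 = ∑ x ∈ s, f x := by
  have hn : (n : ℂ) ≠ 0 := Nat.cast_ne_zero.2 (NeZero.ne n)
  rw [Finset.sum_product]
  simp only [← Finset.mul_sum]
  rw [Finset.sum_const, Finset.card_univ, ZMod.card, nsmul_eq_mul, inv_mul_cancel_left₀ hn]

section StateSum

variable {S : Type} [TopologicalSpace S] [ChartedSpace (EuclideanHalfSpace 2) S]
  [IsManifold (𝓡∂ 2) ∞ S]
variable {o : SurfaceOrientation S} {d la lb : ℕ} (D : HeegaardDiagram o d la lb)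
  (n : ℕ)

namespace HeegaardDiagram

open Classical in
/-- The labelling of the crossings determined by the choice, for each closed `α`-curve, of the
power `a` in the term `K^a X` of the cointegral and of the leg carrying the odd factor of its
iterated coproduct. -/
def stateLabel (p : Fin d → ZMod n × D.Cr) (y : D.Cr) : Idx n :=
  match y.i with
  | .inl i => oddLabel n (D.alongα (.inl i)) (p i).1 (p i).2 y
  | .inr _ => (0, 0)

theorem stateLabel_inl (p : Fin d → ZMod n × D.Cr) {y : D.Cr} {i : Fin d} (hy : y.i = .inl i)
    [DecidableEq D.Cr] :
    D.stateLabel n p y = oddLabel n (D.alongα (.inl i)) (p i).1 (p i).2 y := by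
  simp only [stateLabel, hy]
  convert rfl

theorem stateLabel_inr (p : Fin d → ZMod n × D.Cr) {y : D.Cr} {i : Fin la} (hy : y.i = .inr i) :
    D.stateLabel n p y = (0, 0) := by
  simp only [stateLabel, hy]

/-- A choice of one crossing on each closed `α`-curve. -/
def IsTransversal (p : Fin d → ZMod n × D.Cr) : Prop := ∀ i, (p i).2.i = .inl i

variable {D n} in
theorem IsTransversal.stateLabel_snd {p : Fin d → ZMod n × D.Cr} (hp : D.IsTransversal n p)
    (i : Fin d) : (D.stateLabel n p (p i).2).2 = 1 := by
  classical
  rw [D.stateLabel_inl n p (hp i), oddLabel, if_pos rfl]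

theorem stateLabel_snd_of_notMem {p : Fin d → ZMod n × D.Cr} {y : D.Cr}
    (hy : y ∉ Set.range fun i => (p i).2) : (D.stateLabel n p y).2 = 0 := by
  classical
  rcases hi : y.i with i | i
  · rw [D.stateLabel_inl n p hi, oddLabel, if_neg fun h => hy ⟨i, h.symm⟩]
    split_ifs <;> rfl
  · rw [D.stateLabel_inr n p hi]

variable {D n} in
theorem IsTransversal.injective {p : Fin d → ZMod n × D.Cr} (hp : D.IsTransversal n p) :
    Function.Injective fun i => (p i).2 := fun i i' h => by
  have := congrArg Crossing.i h
  beta_reduce at this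
  rw [hp, hp] at this
  exact Sum.inl_injective this

open Classical in
variable {D n} in
theorem IsTransversal.sum_snd {p : Fin d → ZMod n × D.Cr} (hp : D.IsTransversal n p)
    (j : Fin d ⊕ Fin lb) :
    ∑ x : D.Cr with x.j = j, ((D.stateLabel n p x).2 : ℕ) =
      (Finset.univ.filter fun i => (p i).2.j = j).card := by
  rw [Finset.sum_filter, Finset.card_filter]
  symm
  refine Fintype.sum_of_injective _ hp.injective _ _ (fun x hx => ?_) fun i => ?_
  · simp [D.stateLabel_snd_of_notMem n hx]
  · simp [hp.stateLabel_snd]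

open Classical in
/-- Along each closed `α`-curve, the scalars of the legs multiply to the term of the Fox derivative
at the odd leg; the common power `K^a` contributes trivially. -/
theorem IsTransversal.prod_legValue {p : Fin d → ZMod n × D.Cr}
    {ψ : Fin d ⊕ Fin lb → GBdual n}
    (hψ : ∀ (i : Fin d) (a : ZMod n), ∏ x : D.Cr with x.i = .inl i,
      evalKpow n a (ψ x.j) ^ (D.crossingSign x : ℤ) = 1) :
    ∏ x, legValue n (ψ x.j) (D.crossingSign x) (D.stateLabel n p x) =
      ∏ i, foxTerm (fun y : D.Cr => evalKpow n 1 (ψ y.j)) D.crossingSign (D.alongα (.inl i))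
        (p i).2 := by
  rw [← Finset.prod_fiberwise Finset.univ (fun x : D.Cr => x.i), Fintype.prod_sum_type,
    Finset.prod_eq_one (s := (Finset.univ : Finset (Fin la))), mul_one]
  · refine Finset.prod_congr rfl fun i _ => ?_
    rw [foxTerm, toFinset_alongα]
    refine Eq.trans ?_ ((congrArg (· * _) (hψ i (p i).1)).trans (one_mul _))
    rw [← Finset.prod_mul_distrib]
    refine Finset.prod_congr rfl fun x hx => ?_
    rw [D.stateLabel_inl n p (Finset.mem_filter.1 hx).2,
      legValue_oddLabel n _ _ (D.crossingSign_ne_zero x)]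
  · intro i _
    refine Finset.prod_eq_one fun x hx => ?_
    rw [D.stateLabel_inr n p (Finset.mem_filter.1 hx).2,
      legValue_even n _ (D.crossingSign_ne_zero x), evalKpow_zero, one_zpow]

variable [NeZero n]

open Classical in
/-- The tensor of a closed `α`-curve: a sum over the power of `K` and the position of the odd
factor. -/
theorem iterComul_cointegral (s : D.Cr → Idx n) (i : Fin d ⊕ Fin la) :
    iterComul n ((D.alongα i).map s) (cointegral n) =
      ∑ q ∈ Finset.univ ×ˢ Finset.univ.filter (fun x : D.Cr => x.i = i), (n : ℂ)⁻¹ *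
        ∏ y : D.Cr with y.i = i, if s y = oddLabel n (D.alongα i) q.1 q.2 y then 1 else 0 := by
  rw [cointegral, map_smul, map_sum, Finset.sum_product, smul_eq_mul, Finset.mul_sum]
  refine Finset.sum_congr rfl fun a _ => ?_
  rw [iterComul_map_odd n (D.nodup_alongα i), Finset.mul_sum, toFinset_alongα]

open Classical in
theorem iterComul_one (s : D.Cr → Idx n) (i : Fin d ⊕ Fin la) :
    iterComul n ((D.alongα i).map s) 1 =
      ∏ y : D.Cr with y.i = i, if s y = (0, 0) then 1 else 0 := by
  have : (1 : Hn n) = bas n (0, 0) := by rw [bas_zero, Kpow_zero, TrivSqZeroExt.inl_one]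
  rw [this, iterComul_map_even n (D.nodup_alongα i), toFinset_alongα]

open Classical in
/-- The tensors of the `α`-curves, expanded over states. -/
theorem prod_iterComul (s : D.Cr → Idx n) :
    (∏ i : Fin d, iterComul n ((D.alongα (.inl i)).map s) (cointegral n)) *
        (∏ i : Fin la, iterComul n ((D.alongα (.inr i)).map s) 1) =
      ∑ p ∈ Fintype.piFinset fun i : Fin d => (Finset.univ : Finset (ZMod n)) ×ˢ
          Finset.univ.filter (fun x : D.Cr => x.i = .inl i),
        (n : ℂ)⁻¹ ^ d * if s = D.stateLabel n p then 1 else 0 := by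
  simp only [iterComul_cointegral, iterComul_one]
  rw [Finset.prod_univ_sum, Finset.sum_mul]
  refine Finset.sum_congr rfl fun p _ => ?_
  rw [Finset.prod_mul_distrib, mul_assoc, Finset.prod_const, Finset.card_univ, Fintype.card_fin]
  congr 1
  have h : (if s = D.stateLabel n p then (1 : ℂ) else 0) =
      ∏ y, if s y = D.stateLabel n p y then 1 else 0 := by
    rw [Finset.prod_ite_zero]
    simp [funext_iff]
  rw [h, ← Finset.prod_fiberwise Finset.univ (fun x : D.Cr => x.i), Fintype.prod_sum_type]
  congr 1
  · refine Finset.prod_congr rfl fun i _ => Finset.prod_congr rfl fun y hy => ?_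
    rw [D.stateLabel_inl n p (Finset.mem_filter.1 hy).2]
  · refine Finset.prod_congr rfl fun i _ => Finset.prod_congr rfl fun y hy => ?_
    rw [D.stateLabel_inr n p (Finset.mem_filter.1 hy).2]

open Classical in
/-- A state contributes only if its odd legs are matched by a permutation with the closed
`β`-curves. -/
theorem stateLabel_term {p : Fin d → ZMod n × D.Cr} (hp : D.IsTransversal n p)
    (ψ : Fin d ⊕ Fin lb → GBdual n) :
    D.koszulSign n (D.stateLabel n p) *
        (∏ j : Fin d, (ψ (.inl j)).ofConv
          (relIntegral n (D.productAlong n (D.stateLabel n p) (.inl j)))) *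
        (∏ j : Fin lb, (ψ (.inr j)).ofConv
          (projB n (D.productAlong n (D.stateLabel n p) (.inr j)))) =
      (∑ σ : Equiv.Perm (Fin d), ((Equiv.Perm.sign σ : ℤ) : ℂ) *
        ∏ i, if (p i).2.j = .inl (σ i) then 1 else 0) *
        ∏ x, legValue n (ψ x.j) (D.crossingSign x) (D.stateLabel n p x) := by
  have hprod : (∏ j : Fin d, (ψ (.inl j)).ofConv
          (relIntegral n (D.productAlong n (D.stateLabel n p) (.inl j)))) *
        (∏ j : Fin lb, (ψ (.inr j)).ofConv
          (projB n (D.productAlong n (D.stateLabel n p) (.inr j)))) =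
      if (∀ j : Fin d, (Finset.univ.filter fun i => (p i).2.j = .inl j).card = 1) ∧
          ∀ j : Fin lb, (Finset.univ.filter fun i => (p i).2.j = .inr j).card = 0 then
        ∏ x, legValue n (ψ x.j) (D.crossingSign x) (D.stateLabel n p x) else 0 := by
    simp only [relIntegral_productAlong, projB_productAlong, hp.sum_snd]
    rw [Finset.prod_ite_zero, Finset.prod_ite_zero,
      ← Finset.prod_fiberwise Finset.univ (fun x : D.Cr => x.j), Fintype.prod_sum_type]
    have hleg : ∀ j, ∏ x : D.Cr with x.j = j, legValue n (ψ x.j) (D.crossingSign x)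
        (D.stateLabel n p x) = ∏ x : D.Cr with x.j = j, legValue n (ψ j) (D.crossingSign x)
        (D.stateLabel n p x) := fun j => Finset.prod_congr rfl fun x hx => by
      rw [(Finset.mem_filter.1 hx).2]
    simp only [hleg, Finset.mem_univ, true_imp_iff]
    split_ifs <;> simp_all
  rw [mul_assoc, hprod]
  split_ifs with h
  · obtain ⟨h1, h2⟩ := h
    have hf : ∀ i, ∃ j, (p i).2.j = .inl j := fun i => by
      rcases hj : (p i).2.j with j | j
      · exact ⟨j, rfl⟩
      · exact absurd (Finset.mem_filter.2 ⟨Finset.mem_univ i, hj⟩)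
          (by rw [Finset.card_eq_zero.1 (h2 j)]; exact Finset.notMem_empty i)
    choose f hf using hf
    have hinj : Function.Injective f := fun i i' hii' =>
      Finset.card_le_one.1 (h1 (f i)).le i (by simp [hf]) i' (by simp [hf, hii'])
    let σ : Equiv.Perm (Fin d) := Equiv.ofBijective f (Finite.injective_iff_bijective.1 hinj)
    have hσ : ∀ i, (p i).2.j = .inl (σ i) := hf
    rw [D.koszulSign_eq_sign n hp hσ hp.stateLabel_snd
      fun x hx => D.stateLabel_snd_of_notMem n hx, Finset.sum_eq_single σ]
    · simp [hσ]
    · intro τ _ hτ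
      obtain ⟨i, hi⟩ : ∃ i, τ i ≠ σ i := by
        by_contra! h
        exact hτ (Equiv.ext h)
      rw [Finset.prod_eq_zero (Finset.mem_univ i), mul_zero]
      rw [hσ, if_neg fun h => hi (Sum.inl_injective h).symm]
    · simp
  · rw [mul_zero, Finset.sum_eq_zero, zero_mul]
    intro σ _
    rw [Finset.prod_ite_zero, if_neg, mul_zero]
    intro hσ
    refine h ⟨fun j => ?_, fun j => ?_⟩
    · rw [Finset.card_eq_one]
      refine ⟨σ.symm j, ?_⟩
      ext i
      simp [hσ i (Finset.mem_univ i), Equiv.eq_symm_apply]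
    · simp [hσ]

open Classical in
/-- If the characters `ψ` multiply to one along each closed `α`-curve, the scalar `Z` is the
determinant of the matrix of sums of Fox terms. -/
theorem Z_eq_det {ψ : Fin d ⊕ Fin lb → GBdual n}
    (hψ : ∀ (i : Fin d) (a : ZMod n), ∏ x : D.Cr with x.i = .inl i,
      evalKpow n a (ψ x.j) ^ (D.crossingSign x : ℤ) = 1) :
    D.Z n ψ = Matrix.det (Matrix.of fun i j : Fin d =>
      ∑ x : D.Cr with x.i = .inl i ∧ x.j = .inl j,
        foxTerm (fun y : D.Cr => evalKpow n 1 (ψ y.j)) D.crossingSign (D.alongα (.inl i)) x) := by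
  set P := Fintype.piFinset fun i : Fin d => (Finset.univ : Finset (ZMod n)) ×ˢ
    Finset.univ.filter (fun x : D.Cr => x.i = .inl i) with hP
  have hPt : ∀ p ∈ P, D.IsTransversal n p := fun p hp i =>
    (Finset.mem_filter.1 (Finset.mem_product.1 (Fintype.mem_piFinset.1 hp i)).2).2
  have hZ : D.Z n ψ = ∑ p ∈ P, (n : ℂ)⁻¹ ^ d *
      ((∑ σ : Equiv.Perm (Fin d), ((Equiv.Perm.sign σ : ℤ) : ℂ) *
        ∏ i, if (p i).2.j = .inl (σ i) then 1 else 0) *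
      ∏ i, foxTerm (fun y : D.Cr => evalKpow n 1 (ψ y.j)) D.crossingSign (D.alongα (.inl i))
        (p i).2) := by
    unfold Z
    have : ∀ s : D.Cr → Idx n, D.koszulSign n s *
        (∏ i : Fin d, iterComul n ((D.alongα (.inl i)).map s) (cointegral n)) *
        (∏ i : Fin la, iterComul n ((D.alongα (.inr i)).map s) 1) *
        (∏ j : Fin d, (ψ (.inl j)).ofConv (relIntegral n (D.productAlong n s (.inl j)))) *
        (∏ j : Fin lb, (ψ (.inr j)).ofConv (projB n (D.productAlong n s (.inr j)))) =
        ∑ p ∈ P, if s = D.stateLabel n p then (n : ℂ)⁻¹ ^ d * (D.koszulSign n s *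
          (∏ j : Fin d, (ψ (.inl j)).ofConv (relIntegral n (D.productAlong n s (.inl j)))) *
          (∏ j : Fin lb, (ψ (.inr j)).ofConv (projB n (D.productAlong n s (.inr j))))) else 0 := by
      intro s
      rw [mul_assoc (D.koszulSign n s), prod_iterComul, Finset.mul_sum, Finset.sum_mul,
        Finset.sum_mul]
      refine Finset.sum_congr rfl fun p _ => ?_
      split_ifs <;> ring
    simp only [this]
    rw [Finset.sum_comm]
    refine Finset.sum_congr rfl fun p hp => ?_
    rw [Finset.sum_ite_eq' Finset.univ (D.stateLabel n p), if_pos (Finset.mem_univ _),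
      D.stateLabel_term n (hPt p hp), IsTransversal.prod_legValue D n hψ]
  rw [hZ, ← Matrix.det_transpose, Matrix.det_apply']
  simp only [Finset.sum_mul, Finset.mul_sum]
  rw [Finset.sum_comm]
  refine Finset.sum_congr rfl fun σ _ => ?_
  have hM : ∀ i, ∑ x : D.Cr with x.i = .inl i ∧ x.j = .inl (σ i),
      foxTerm (fun y : D.Cr => evalKpow n 1 (ψ y.j)) D.crossingSign (D.alongα (.inl i)) x =
      ∑ q ∈ (Finset.univ : Finset (ZMod n)) ×ˢ Finset.univ.filter (fun x : D.Cr => x.i = .inl i),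
        (n : ℂ)⁻¹ * ((if q.2.j = .inl (σ i) then 1 else 0) *
          foxTerm (fun y : D.Cr => evalKpow n 1 (ψ y.j)) D.crossingSign (D.alongα (.inl i)) q.2) :=
    fun i => by
      refine Eq.trans ?_ (sum_zmod_product n _ fun x : D.Cr =>
        (if x.j = .inl (σ i) then (1 : ℂ) else 0) *
          foxTerm (fun y : D.Cr => evalKpow n 1 (ψ y.j)) D.crossingSign
            (D.alongα (.inl i)) x).symm
      rw [← Finset.filter_filter, Finset.sum_filter]
      exact Finset.sum_congr rfl fun x _ => by split_ifs <;> simp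
  simp only [Matrix.transpose_apply, Matrix.of_apply, hM]
  rw [Finset.prod_univ_sum, Finset.mul_sum]
  refine Finset.sum_congr rfl fun p _ => ?_
  rw [Finset.prod_mul_distrib, Finset.prod_mul_distrib, Finset.prod_const, Finset.card_univ,
    Fintype.card_fin]
  ring

end HeegaardDiagram

end StateSum

/-! ### Evaluation of characters at `K` -/

section Evaluation

variable {M : Type} [TopologicalSpace M] (n : ℕ)
  (ρ : Multiplicative (H1 M) →* GBdual n)

/-- A homomorphism `ρ : H₁(M) → G(B*)`, evaluated at `K^a`, sends a vanishing signed sum of classes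
to a product equal to one. -/
theorem prod_evalKpow_eq_one {ι : Type} {s : Finset ι} {m : ι → ℤ} {h : ι → H1 M}
    (hsum : ∑ x ∈ s, m x • h x = 0) (a : ZMod n) :
    ∏ x ∈ s, evalKpow n a (ρ (Multiplicative.ofAdd (h x))) ^ m x = 1 := by
  let Φ : Multiplicative (H1 M) →* ℂˣ := ((evalKpow n a).comp ρ).toHomUnits
  have h1 : ∏ x ∈ s, Φ (Multiplicative.ofAdd (h x)) ^ m x = 1 := by
    simp only [← map_zpow, ← map_prod, ← ofAdd_zsmul, ← ofAdd_sum]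
    rw [hsum, ofAdd_zero, map_one]
  have h2 := congrArg Units.val h1
  rw [Units.coe_prod, Units.val_one] at h2
  rw [← h2]
  exact Finset.prod_congr rfl fun x _ => by
    rw [Units.val_zpow_eq_zpow_val]; rfl

theorem rhoK_toHomologyRing_of [NeZero n] {κ : Type} (h : κ → H1 M) (k : κ) :
    rhoK n ρ (toHomologyRing h (MonoidAlgebra.of ℤ _ (FreeGroup.of k))) =
      evalKpow n 1 (ρ (Multiplicative.ofAdd (h k))) := by
  simp [rhoK, toHomologyRing, evalKpow, evalK]

end Evaluation

end

end Sutured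

theorem mainTheorem3 (n : ℕ) [NeZero n]
    (S : Type) [TopologicalSpace S] [T2Space S] [CompactSpace S]
    [ChartedSpace (EuclideanHalfSpace 2) S] [IsManifold (𝓡∂ 2) ∞ S]
    (o : Sutured.SurfaceOrientation S) (d la lb : ℕ)
    (D : Sutured.HeegaardDiagram o d la lb)
    (M : Type) [TopologicalSpace M] (e : D.manifold ≃ₜ M)
    (hR : IsConnected (e '' Sutured.Rminus D.α D.β))
    (βdual : Fin d ⊕ Fin lb → Sutured.H1 M) (hβ : D.IsDualFamily e βdual)
    (ρ : Multiplicative (Sutured.H1 M) →* Sutured.GBdual n) :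
    D.Z n (fun j => ρ (Multiplicative.ofAdd (βdual j))) =
      Matrix.det (Matrix.of fun i j : Fin d =>
        Sutured.rhoK n ρ (Sutured.toHomologyRing βdual
          (Sutured.fox (.inl j) (D.word (.inl i))))) := by
  classical
  rw [D.Z_eq_det n fun i a => Sutured.prod_evalKpow_eq_one n ρ (D.sum_crossings_eq_zero e hβ i) a]
  congr 2
  ext i j
  have h := Sutured.fox_word ((Sutured.rhoK n ρ).comp (Sutured.toHomologyRing βdual))
    (fun k => Sutured.evalKpow n 1 (ρ (Multiplicative.ofAdd (βdual k))))
    (Sutured.rhoK_toHomologyRing_of n ρ βdual) (fun x : D.Cr => x.j) D.crossingSign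
    D.crossingSign_ne_zero (.inl j) (D.nodup_alongα (.inl i))
  rw [D.toFinset_alongα, Finset.filter_filter] at h
  refine Eq.trans ?_ (h.symm.trans ?_)
  · rfl
  · rfl
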